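/- Setting. Let $Y\subseteq\mathbb R^d$ and $U\subseteq\mathbb R^l$ be bounded and open (with Lebesgue measure), $0<T<\infty$, $N\ge 1$, and let $\sigma:\mathbb R\to\mathbb R$ be Lipschitz continuous and differentiable with $\sigma'>0$ on $\mathbb R$. Let $f_I^{(j)}\in L^2(Y)$ and $P^{(j)}\in L^2(U)$, $j=1,\dots,N$, be given. For $a\in L^2(Y\times(0,T))$ and $b\in L^2(Y\times Y\times(0,T))$ let $f^{(j)}\in C([0,T];L^2(Y))$ be the (unique) solution of the forward problem $$\partial_t f^{(j)}(y,t)=\sigma\Big(a(y,t)-\int_Y b(y,z,t)f^{(j)}(z,t)\,dz\Big),\qquad f^{(j)}(y,0)=f^{(j)}_I(y),$$ understood in its time-integrated form. For $w\in L^2(U\times Y)$ and $\mu\in L^2(U)$ put $Z^{(j)}(u)=\int_Y w(u,y)f^{(j)}(y,T)\,dy+\mu(u)$ and, for $h:\mathbb R\to\mathbb R$, $$J(a,b,w,\mu)=\frac1{2N}\sum_{j=1}^N\int_U\big|h(Z^{(j)}(u))-P^{(j)}(u)\big|^2du .$$ A critical point of $J$ is a point of $L^2(Y\times(0,T))\times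 L^2(Y\times Y\times(0,T))\times L^2(U\times Y)\times L^2(U)$ at which the Gateaux derivative of $J$ exists and vanishes. The functions $f_I^{(j)}$ are called weakly linearly independent if $\sum_j\lambda_j=0$ and $\sum_j\lambda_jf_I^{(j)}=0$ a.e. in $Y$ imply $\lambda_1=\dots=\lambda_N=0$. Theorem. Let $\{f_I^{(j)}\}_{j=1,\dots,N}$ be weakly linearly independent and $h(\xi)=\xi$ for all $\xi\in\mathbb R$. Let $(a,b,w,\mu)\in L^2(Y\times(0,T))\times L^2(Y\times Y\times(0,T))\times L^2(U\times Y)\times L^2(U)$, let $f^{(j)}$ be the corresponding forward solutions, let $K$ be the dimension of $\mathrm{span}\{f^{(1)}(\cdot,T),\dots,f^{(N)}(\cdot,T)\}$, and let $\{s_1,\dots,s_K\}$ be any orthonormal system (with respect to $L^2(Y)$) in this span. Put $P(u)=(P^{(1)}(u),\dots,P^{(N)}(u))^{\mathrm{tr}}$, $\tilde e=\frac1{\sqrt N}(1,\dots,1)^{\mathrm{tr}}\in\mathbb R^N$, $\Omega_{ij}=\int_Y f^{(i)}(y,T)s_j(y)\,dy$ ($i\le N$, $j\le K$) and $A=(I-\tilde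 e\otimes\tilde e)\,\Omega\in\mathbb R^{N\times K}$. Then $(a,b,w,\mu)$ is a critical point of $J$ if and only if all of the following hold: 1. for $j=1,\dots,N$, $f^{(j)}(\cdot,T)$ is a least-squares solution of "$Wf^{(j)}(\cdot,T)=P^{(j)}-\mu$", i.e. $W^*Wf^{(j)}(\cdot,T)=W^*(P^{(j)}-\mu)$, where $W:L^2(Y)\to L^2(U)$, $(W\varphi)(u)=\int_Y w(u,y)\varphi(y)\,dy$; 2. $w(u,y)=\sum_{j=1}^K w_j(u)s_j(y)+h_w(u,y)$ for a.e. $(u,y)$, where $h_w\in L^2(U\times Y)$, $h_w(u,\cdot)\perp s_1,\dots,s_K$ in $L^2(Y)$ for a.e. $u\in U$, and $(w_1,\dots,w_K)\in L^2(U)^K$ solves $$A^{\mathrm{tr}}A\,(w_1(u),\dots,w_K(u))^{\mathrm{tr}}=A^{\mathrm{tr}}P(u)\quad\text{for a.e. }u\in U;$$ 3. with the same $w_1,\dots,w_K$, $$\mu(u)=\frac1{\sqrt N}\Big(P(u)\cdot\tilde e-\tilde e^{\mathrm{tr}}\,\Omega\,(w_1(u),\dots,w_K(u))^{\mathrm{tr}}\Big)\quad\text{for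 a.e. }u\in U.$$ -/

import Mathlib

open MeasureTheory Set Module
open scoped NNReal ENNReal Matrix

noncomputable section

namespace ContinuumNet

/-- `ℝⁿ` with the Euclidean norm. -/
abbrev Pt (n : ℕ) : Type := EuclideanSpace ℝ (Fin n)

/-- Lebesgue measure on a subset `S` of `ℝⁿ`. -/
abbrev leb {n : ℕ} (S : Set (Pt n)) : Measure (Pt n) := volume.restrict S

/-- Lebesgue measure on the time interval `(0, T)`. -/
abbrev timeMeasure (T : ℝ) : Measure ℝ := volume.restrict (Ioo 0 T)

/-- The real Hilbert space `L²(ρ)`. -/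
abbrev L2 {α : Type*} [MeasurableSpace α] (ρ : Measure α) : Type _ := Lp ℝ 2 ρ

/-- `L²(Y × (0, T))`, the space of the network biases `a(y, t)`. -/
abbrev BiasSpace {d : ℕ} (Y : Set (Pt d)) (T : ℝ) : Type :=
  L2 ((leb Y).prod (timeMeasure T))

/-- `L²(Y × Y × (0, T))`, the space of the network weights `b(y, z, t)`. -/
abbrev WeightSpace {d : ℕ} (Y : Set (Pt d)) (T : ℝ) : Type :=
  L2 ((leb Y).prod ((leb Y).prod (timeMeasure T)))

/-- `L²(U × Y)`, the space of the terminal weights `w(u, y)`. -/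
abbrev TerminalWeightSpace {d l : ℕ} (U : Set (Pt l)) (Y : Set (Pt d)) : Type :=
  L2 ((leb U).prod (leb Y))

/-- The space of all control parameters `(a, b, w, μ)`. -/
abbrev ControlSpace {d l : ℕ} (Y : Set (Pt d)) (U : Set (Pt l)) (T : ℝ) : Type :=
  BiasSpace Y T × WeightSpace Y T × TerminalWeightSpace U Y × L2 (leb U)

/-- Weak linear independence: a vanishing linear combination whose coefficients add up to zero
is trivial. -/
def WeaklyLinearIndependent {N : ℕ} {V : Type*} [AddCommGroup V] [Module ℝ V]
    (φ : Fin N → V) : Prop :=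
  ∀ c : Fin N → ℝ, ∑ j, c j = 0 → ∑ j, c j • φ j = 0 → ∀ j, c j = 0

/-! ### Integral operators with square integrable kernel -/

section Kernel

theorem eLpNorm_two_eq {γ : Type*} [MeasurableSpace γ] (m : Measure γ) (g : γ → ℝ) :
    eLpNorm g 2 m = (∫⁻ x, ‖g x‖ₑ ^ (2 : ℝ) ∂m) ^ (1 / 2 : ℝ) := by
  rw [eLpNorm_eq_lintegral_rpow_enorm_toReal (by norm_num) (by norm_num)]
  simp

variable {α β : Type*} [MeasurableSpace α] [MeasurableSpace β]
  {ρ : Measure α} {ν : Measure β} [SFinite ν]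

theorem slice_memLp [SFinite ρ] (k : L2 (ρ.prod ν)) : ∀ᵐ u ∂ρ, MemLp (fun y => k (u, y)) 2 ν := by
  have h2 : Integrable (fun p => (k p) ^ 2) (ρ.prod ν) :=
    (memLp_two_iff_integrable_sq (Lp.aestronglyMeasurable k)).1 (Lp.memLp k)
  filter_upwards [h2.prod_right_ae, (Lp.aestronglyMeasurable k).prodMk_left] with u hu hm
  exact (memLp_two_iff_integrable_sq hm).2 hu

theorem slice_integrable [SFinite ρ] (k : L2 (ρ.prod ν)) (φ : L2 ν) :
    ∀ᵐ u ∂ρ, Integrable (fun y => k (u, y) * φ y) ν := by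
  filter_upwards [slice_memLp k] with u hu
  exact hu.integrable_mul (Lp.memLp φ)

theorem kernel_aesm (k : L2 (ρ.prod ν)) (φ : L2 ν) :
    AEStronglyMeasurable (fun u => ∫ y, k (u, y) * φ y ∂ν) ρ := by
  have h : AEStronglyMeasurable (fun p : α × β => k p * φ p.2) (ρ.prod ν) :=
    (Lp.aestronglyMeasurable k).mul (Lp.aestronglyMeasurable φ).comp_snd
  exact h.integral_prod_right'

theorem kernel_eLpNorm_le (k : L2 (ρ.prod ν)) (φ : L2 ν) :
    eLpNorm (fun u => ∫ y, k (u, y) * φ y ∂ν) 2 ρ ≤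
      eLpNorm k 2 (ρ.prod ν) * eLpNorm φ 2 ν := by
  have key : ∀ᵐ u ∂ρ, ‖∫ y, k (u, y) * φ y ∂ν‖ₑ ^ (2 : ℝ) ≤
      (∫⁻ y, ‖k (u, y)‖ₑ ^ (2 : ℝ) ∂ν) * (∫⁻ y, ‖φ y‖ₑ ^ (2 : ℝ) ∂ν) := by
    filter_upwards [(Lp.aestronglyMeasurable k).prodMk_left] with u hm
    have h1 : ‖∫ y, k (u, y) * φ y ∂ν‖ₑ ≤
        (∫⁻ y, ‖k (u, y)‖ₑ ^ (2 : ℝ) ∂ν) ^ (1 / 2 : ℝ) *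
          (∫⁻ y, ‖φ y‖ₑ ^ (2 : ℝ) ∂ν) ^ (1 / 2 : ℝ) := by
      refine (enorm_integral_le_lintegral_enorm _).trans ?_
      simp only [enorm_mul]
      exact ENNReal.lintegral_mul_le_Lp_mul_Lq ν Real.HolderConjugate.two_two
        hm.enorm (Lp.aestronglyMeasurable φ).enorm
    calc _ ≤ _ := ENNReal.rpow_le_rpow h1 (by norm_num : (0 : ℝ) ≤ 2)
      _ = _ := by
        rw [ENNReal.mul_rpow_of_nonneg _ _ (by norm_num), ← ENNReal.rpow_mul, ← ENNReal.rpow_mul]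
        norm_num
  rw [eLpNorm_two_eq ρ, eLpNorm_two_eq (ρ.prod ν), eLpNorm_two_eq ν, ← ENNReal.mul_rpow_of_nonneg _ _ (by norm_num)]
  refine ENNReal.rpow_le_rpow ?_ (by norm_num)
  refine (lintegral_mono_ae key).trans ?_
  have hk : AEMeasurable (fun p => ‖k p‖ₑ ^ (2 : ℝ)) (ρ.prod ν) :=
    (Lp.aestronglyMeasurable k).enorm.pow_const _
  rw [lintegral_mul_const'' _ hk.lintegral_prod_right', ← lintegral_prod _ hk]

theorem kernel_memLp (k : L2 (ρ.prod ν)) (φ : L2 ν) :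
    MemLp (fun u => ∫ y, k (u, y) * φ y ∂ν) 2 ρ :=
  ⟨kernel_aesm k φ, (kernel_eLpNorm_le k φ).trans_lt
    (ENNReal.mul_lt_top (Lp.eLpNorm_lt_top k) (Lp.eLpNorm_lt_top φ))⟩

/-- The integral operator `(W φ)(u) = ∫ w(u, y) φ(y) dy` with kernel `w ∈ L²`, as a bounded
linear operator between the `L²` spaces. -/
def kernelOp [SFinite ρ] (w : L2 (ρ.prod ν)) : L2 ν →L[ℝ] L2 ρ :=
  LinearMap.mkContinuous
    { toFun := fun φ => (kernel_memLp w φ).toLp (fun u => ∫ y, w (u, y) * φ y ∂ν)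
      map_add' := by
        intro φ ψ
        rw [← MemLp.toLp_add]
        refine MemLp.toLp_congr _ _ ?_
        filter_upwards [slice_integrable w φ, slice_integrable w ψ] with u h1 h2
        rw [Pi.add_apply, ← integral_add h1 h2]
        refine integral_congr_ae ?_
        filter_upwards [Lp.coeFn_add φ ψ] with y hy
        rw [hy, Pi.add_apply, mul_add]
      map_smul' := by
        intro c φ
        rw [RingHom.id_apply, ← MemLp.toLp_const_smul]
        refine MemLp.toLp_congr _ _ (Filter.Eventually.of_forall fun u => ?_)
        rw [Pi.smul_apply, smul_eq_mul, ← integral_const_mul]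
        refine integral_congr_ae ?_
        filter_upwards [Lp.coeFn_smul c φ] with y hy
        rw [hy, Pi.smul_apply, smul_eq_mul]
        ring }
    ‖w‖ (by
      intro φ
      rw [LinearMap.coe_mk, AddHom.coe_mk, Lp.norm_toLp, Lp.norm_def, Lp.norm_def,
        ← ENNReal.toReal_mul]
      exact ENNReal.toReal_mono
        (ENNReal.mul_lt_top (Lp.eLpNorm_lt_top w) (Lp.eLpNorm_lt_top φ)).ne
        (kernel_eLpNorm_le w φ))

theorem kernelOp_apply [SFinite ρ] (w : L2 (ρ.prod ν)) (φ : L2 ν) :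
    kernelOp w φ =ᵐ[ρ] fun u => ∫ y, w (u, y) * φ y ∂ν :=
  MemLp.coeFn_toLp (kernel_memLp w φ)

end Kernel

/-! ### Least-squares solutions -/

/-- `ξ` is a least-squares solution of "`W ξ = g`": it solves the normal equation
`W* W ξ = W* g`. -/
def IsLeastSquaresSolution {H₁ H₂ : Type*}
    [NormedAddCommGroup H₁] [InnerProductSpace ℝ H₁] [CompleteSpace H₁]
    [NormedAddCommGroup H₂] [InnerProductSpace ℝ H₂] [CompleteSpace H₂]
    (W : H₁ →L[ℝ] H₂) (g : H₂) (ξ : H₁) : Prop :=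
  ContinuousLinearMap.adjoint W (W ξ) = ContinuousLinearMap.adjoint W g

/-- Least-squares solutions are exactly the minimizers of the residual `‖W ζ - g‖`. -/
theorem isLeastSquaresSolution_iff {H₁ H₂ : Type*}
    [NormedAddCommGroup H₁] [InnerProductSpace ℝ H₁] [CompleteSpace H₁]
    [NormedAddCommGroup H₂] [InnerProductSpace ℝ H₂] [CompleteSpace H₂]
    (W : H₁ →L[ℝ] H₂) (g : H₂) (ξ : H₁) :
    IsLeastSquaresSolution W g ξ ↔ ∀ ζ : H₁, ‖W ξ - g‖ ≤ ‖W ζ - g‖ := by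
  have h0 : IsLeastSquaresSolution W g ξ ↔ ∀ η : H₁, inner ℝ (W ξ - g) (W η) = 0 := by
    unfold IsLeastSquaresSolution
    rw [← sub_eq_zero, ← map_sub]
    constructor
    · intro h η
      rw [← ContinuousLinearMap.adjoint_inner_left, h, inner_zero_left]
    · intro h
      have := h (ContinuousLinearMap.adjoint W (W ξ - g))
      rwa [← ContinuousLinearMap.adjoint_inner_left, inner_self_eq_zero] at this
  have hexp : ∀ η : H₁, ‖W (ξ + η) - g‖ ^ 2 =
      ‖W ξ - g‖ ^ 2 + 2 * inner ℝ (W ξ - g) (W η) + ‖W η‖ ^ 2 := by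
    intro η
    rw [← norm_add_sq_real, map_add]
    congr 2
    abel
  rw [h0]
  constructor
  · intro h ζ
    have e := hexp (ζ - ξ)
    rw [h, add_sub_cancel] at e
    refine le_of_sq_le_sq ?_ (norm_nonneg _)
    nlinarith [sq_nonneg ‖W (ζ - ξ)‖]
  · intro h η
    set p := inner ℝ (W ξ - g) (W η) with hp
    set q := ‖W η‖ ^ 2 with hq
    have hq0 : 0 ≤ q := sq_nonneg _
    have key : ∀ t : ℝ, 0 ≤ 2 * (t * p) + t ^ 2 * q := by
      intro t
      have e := hexp (t • η)
      rw [map_smul, inner_smul_right, norm_smul, mul_pow, Real.norm_eq_abs, sq_abs] at e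
      have := pow_le_pow_left₀ (norm_nonneg _) (h (ξ + t • η)) 2
      linarith
    have h1 := key (-p / (q + 1))
    have h2 : 2 * (-p / (q + 1) * p) + (-p / (q + 1)) ^ 2 * q =
        -(p ^ 2 * (q + 2)) / (q + 1) ^ 2 := by
      field_simp
      ring
    rw [h2, neg_div, Left.nonneg_neg_iff] at h1
    by_contra hne
    have : 0 < p ^ 2 * (q + 2) / (q + 1) ^ 2 := by positivity
    linarith

/-! ### Forward propagation and loss functional -/

section Network

variable {d l N : ℕ} {Y : Set (Pt d)} {U : Set (Pt l)}

/-- `f ∈ C([0, T]; L²(Y))` solves the forward problem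
`∂ₜ f(y, t) = σ(a(y, t) - ∫_Y b(y, z, t) f(z, t) dz)`, `f(y, 0) = f_I(y)`,
in its time-integrated form. -/
structure IsForwardSolution (σ : ℝ → ℝ) (T : ℝ) (a : BiasSpace Y T) (b : WeightSpace Y T)
    (fI : L2 (leb Y)) (f : ℝ → L2 (leb Y)) : Prop where
  continuousOn : ContinuousOn f (Icc 0 T)
  equation : ∀ t ∈ Icc 0 T, f t =ᵐ[leb Y] fun y =>
    fI y + ∫ s in (0 : ℝ)..t, σ (a (y, s) - ∫ z in Y, b (y, z, s) * f s z)

/-- The solution `f_{a, b}` of the forward problem (for Lipschitz `σ` and bounded `Y` it exists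
and is unique on `[0, T]`). -/
def forwardState (σ : ℝ → ℝ) (T : ℝ) (a : BiasSpace Y T) (b : WeightSpace Y T)
    (fI : L2 (leb Y)) : ℝ → L2 (leb Y) :=
  Classical.epsilon (IsForwardSolution σ T a b fI)

/-- The terminal states `f^{(j)}(·, T)`. -/
def terminalState (σ : ℝ → ℝ) (T : ℝ) (fI : Fin N → L2 (leb Y)) (a : BiasSpace Y T)
    (b : WeightSpace Y T) (j : Fin N) : L2 (leb Y) :=
  forwardState σ T a b (fI j) T

/-- The network output `Z(u) = ∫_Y w(u, y) f(y) dy + μ(u)` for the terminal state `f`. -/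
def networkOutput (w : TerminalWeightSpace U Y) (μ : L2 (leb U)) (f : L2 (leb Y)) (u : Pt l) : ℝ :=
  (∫ y in Y, w (u, y) * f y) + μ u

/-- The loss `J(a, b, w, μ) = 1 / (2 N) ∑ⱼ ∫_U |h(Z^{(j)}(u)) - P^{(j)}(u)|² du`. -/
def loss (σ h : ℝ → ℝ) (T : ℝ) (fI : Fin N → L2 (leb Y)) (P : Fin N → L2 (leb U))
    (x : ControlSpace Y U T) : ℝ :=
  1 / (2 * (N : ℝ)) * ∑ j, ∫ u in U,
    |h (networkOutput x.2.2.1 x.2.2.2 (terminalState σ T fI x.1 x.2.1 j) u) - P j u| ^ 2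

/-- `x` is a critical point of `J`: the Gateaux derivative of `J` at `x` exists and vanishes,
i.e. `d/dε J(x + ε v) = 0` at `ε = 0` for every direction `v`. -/
def IsCriticalPoint {V : Type*} [AddCommGroup V] [Module ℝ V] (J : V → ℝ) (x : V) : Prop :=
  ∀ v : V, HasLineDerivAt ℝ J 0 x v

/-! ### The finite-dimensional normal system for the classifiers -/

/-- The unit vector `ẽ = (1, …, 1) / √N`. -/
def unitVec (N : ℕ) : Fin N → ℝ := fun _ => 1 / Real.sqrt N

/-- The matrix `Ω_{ij} = ∫_Y f^{(i)}(y) s_j(y) dy`. -/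
def coeffMatrix {K : ℕ} (F : Fin N → L2 (leb Y)) (s : Fin K → L2 (leb Y)) :
    Matrix (Fin N) (Fin K) ℝ :=
  Matrix.of fun i j => ∫ y in Y, F i y * s j y

/-- The matrix `A = (I - ẽ ⊗ ẽ) Ω`. -/
def centeredMatrix {K : ℕ} (F : Fin N → L2 (leb Y)) (s : Fin K → L2 (leb Y)) :
    Matrix (Fin N) (Fin K) ℝ :=
  (1 - Matrix.vecMulVec (unitVec N) (unitVec N)) * coeffMatrix F s

/-- `w(u, y) = ∑ⱼ c_j(u) s_j(y) + h_w(u, y)` with `h_w(u, ·)` orthogonal to all `s_j` in `L²(Y)`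
for a.e. `u`. -/
def HasExpansion {K : ℕ} (w : TerminalWeightSpace U Y) (s : Fin K → L2 (leb Y))
    (c : Fin K → L2 (leb U)) : Prop :=
  ∃ hw : TerminalWeightSpace U Y,
    (∀ᵐ p ∂((leb U).prod (leb Y)), w p = ∑ j, c j p.1 * s j p.2 + hw p) ∧
    ∀ᵐ u ∂(leb U), ∀ j, ∫ y in Y, hw (u, y) * s j y = 0

/-- `c(u)` solves the normal system `Aᵗʳ A c(u) = Aᵗʳ P(u)` for a.e. `u`. -/
def SolvesNormalSystem {K : ℕ} (F : Fin N → L2 (leb Y)) (s : Fin K → L2 (leb Y))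
    (P : Fin N → L2 (leb U)) (c : Fin K → L2 (leb U)) : Prop :=
  ∀ᵐ u ∂(leb U),
    ((centeredMatrix F s)ᵀ * centeredMatrix F s) *ᵥ (fun k => c k u) =
      (centeredMatrix F s)ᵀ *ᵥ (fun j => P j u)

/-- `μ(u) = (P(u) · ẽ - ẽᵗʳ Ω c(u)) / √N` for a.e. `u`. -/
def BiasFormula {K : ℕ} (F : Fin N → L2 (leb Y)) (s : Fin K → L2 (leb Y))
    (P : Fin N → L2 (leb U)) (c : Fin K → L2 (leb U)) (μ : L2 (leb U)) : Prop :=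
  ∀ᵐ u ∂(leb U), μ u = 1 / Real.sqrt N *
    ((fun j => P j u) ⬝ᵥ unitVec N - unitVec N ⬝ᵥ (coeffMatrix F s *ᵥ fun k => c k u))

end Network

end ContinuumNet

end

open ContinuumNet

/-! Let r_j = W f_j(T) + μ - P_j be the residuals. As h is the identity, the loss is quadratic in
the outputs, and along a line with direction (α', β, w', μ') it changes, up to o(t), by (1/N)(∑ ⟪W*
r_j, δf_j⟫ + t ∑ ⟪r_j, W' f_j(T) + μ'⟫), with δf_j the change of the terminal state
(`loss_expansion`). Directions in (w, μ) force ∑ r_j = 0 and ∑ Ω_jk r_j = 0; pointwise in u this is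
a finite-dimensional least-squares problem, and eliminating μ gives conditions 2 and 3
(`residual_orthogonal_iff`). Directions in (a, b) force W* r_j = 0 for every j, which is condition
1; conversely, if W* r_j = 0 the first sum is identically zero. The hard point is therefore: if ∑
⟪g_j, f_j(T)⟫ is stationary in (a, b), then every g_j is zero
(`eq_zero_of_hasDerivAt_terminalState`).

For this the forward problem is written for X = a - ∫ b f as X = a - Cφ - Vσ(X), where C is `stateOp
b` and V is the causal `volterra` operator. Since b is merely square integrable, V is controlled by
its Hilbert-Schmidt norm, which becomes small after conjugation with exp(-γs) (`exists_damping`).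
This yields solvability, Lipschitz dependence on the parameters and the linearized equation
(`hasDerivAt_nemytskii`), although σ acts on L² only as a Gateaux differentiable map.

By duality, stationarity becomes ∑ ⟪p_j, α' - C_β f_I^j - V_β σ(X_j)⟫ = 0, where the p_j solve
adjoint equations with datum g_j. Taking α' = ψ and β = -ψ ⊗ f_I^k gives ∑_j (1 + ⟪f_I^k, f_j(s)⟫)
p_j(·, s) = 0. At s = 0 the matrix is 1 plus the Gram matrix entrywise, and weak linear independence
is what makes it invertible (`det_one_add_gram_ne_zero`); by continuity p_j = 0 for small s. Because
σ' > 0, the adjoint equation can be run forward from time 0, so that p_j and then g_j vanish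
(`eq_zero_of_adjoint_eq_zero_near_zero`). -/

noncomputable section

namespace ContinuumNet

/-! ### Multiplication by bounded functions on L². -/

section Multiplication

variable {α : Type*} [MeasurableSpace α] {ρ : Measure α}

theorem L2_inner_eq (f g : L2 ρ) : inner ℝ f g = ∫ x, f x * g x ∂ρ := by
  rw [L2.inner_def]
  refine integral_congr_ae (Filter.Eventually.of_forall fun x => ?_)
  simp [mul_comm]

theorem L2_norm_sq_eq (f : L2 ρ) : ‖f‖ ^ 2 = ∫ x, (f x) ^ 2 ∂ρ := by
  rw [← real_inner_self_eq_norm_sq, L2_inner_eq]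
  simp only [sq]

theorem L2_norm_le_of_ae_le {f g : L2 ρ} {c : ℝ} (h : ∀ᵐ x ∂ρ, |f x| ≤ c * |g x|) :
    ‖f‖ ≤ c * ‖g‖ :=
  Lp.norm_le_mul_norm_of_ae_le_mul h

theorem memLp_mul_of_bdd {m : α → ℝ} {C : ℝ} (hm : Measurable m) (hC : ∀ᵐ x ∂ρ, |m x| ≤ C)
    (f : L2 ρ) : MemLp (fun x => m x * f x) 2 ρ := by
  refine MemLp.of_le_mul (c := C) (Lp.memLp f)
    (hm.aestronglyMeasurable.mul (Lp.aestronglyMeasurable f)) ?_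
  filter_upwards [hC] with x hx
  rw [norm_mul]
  exact mul_le_mul_of_nonneg_right hx (norm_nonneg _)

/-- Multiplication by an essentially bounded function as an operator on `L²`. -/
def mulOp {m : α → ℝ} {C : ℝ} (hm : Measurable m) (hC : ∀ᵐ x ∂ρ, |m x| ≤ C) : L2 ρ →L[ℝ] L2 ρ :=
  LinearMap.mkContinuous
    { toFun := fun f => (memLp_mul_of_bdd hm hC f).toLp _
      map_add' := by
        intro f g
        rw [← MemLp.toLp_add]
        refine MemLp.toLp_congr _ _ ?_
        filter_upwards [Lp.coeFn_add f g] with x hx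
        rw [hx, Pi.add_apply, Pi.add_apply, mul_add]
      map_smul' := by
        intro c f
        rw [RingHom.id_apply, ← MemLp.toLp_const_smul]
        refine MemLp.toLp_congr _ _ ?_
        filter_upwards [Lp.coeFn_smul c f] with x hx
        rw [hx, Pi.smul_apply, Pi.smul_apply, smul_eq_mul, smul_eq_mul]
        ring }
    C (by
      intro f
      refine L2_norm_le_of_ae_le ?_
      filter_upwards [hC, MemLp.coeFn_toLp (memLp_mul_of_bdd hm hC f)] with x hx h
      simp only [LinearMap.coe_mk, AddHom.coe_mk]
      rw [h, abs_mul]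
      exact mul_le_mul_of_nonneg_right hx (abs_nonneg _))

theorem mulOp_apply {m : α → ℝ} {C : ℝ} (hm : Measurable m) (hC : ∀ᵐ x ∂ρ, |m x| ≤ C)
    (f : L2 ρ) : mulOp hm hC f =ᵐ[ρ] fun x => m x * f x :=
  MemLp.coeFn_toLp (memLp_mul_of_bdd hm hC f)

theorem mulOp_norm_le {m : α → ℝ} {C : ℝ} (hm : Measurable m) (hC : ∀ᵐ x ∂ρ, |m x| ≤ C)
    (f : L2 ρ) : ‖mulOp hm hC f‖ ≤ C * ‖f‖ := by
  refine L2_norm_le_of_ae_le ?_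
  filter_upwards [hC, mulOp_apply hm hC f] with x hx h
  rw [h, abs_mul]
  exact mul_le_mul_of_nonneg_right hx (abs_nonneg _)

theorem mulOp_inner {m : α → ℝ} {C : ℝ} (hm : Measurable m) (hC : ∀ᵐ x ∂ρ, |m x| ≤ C)
    (f g : L2 ρ) : inner ℝ (mulOp hm hC f) g = inner ℝ f (mulOp hm hC g) := by
  rw [L2_inner_eq, L2_inner_eq]
  refine integral_congr_ae ?_
  filter_upwards [mulOp_apply hm hC f, mulOp_apply hm hC g] with x h1 h2
  rw [h1, h2]
  ring

theorem adjoint_mulOp {m : α → ℝ} {C : ℝ} (hm : Measurable m) (hC : ∀ᵐ x ∂ρ, |m x| ≤ C) :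
    ContinuousLinearMap.adjoint (mulOp hm hC) = mulOp hm hC :=
  ((ContinuousLinearMap.eq_adjoint_iff _ _).2 (mulOp_inner hm hC)).symm

theorem mulOp_mulOp_eq_self {m m' : α → ℝ} {C C' : ℝ} (hm : Measurable m)
    (hC : ∀ᵐ x ∂ρ, |m x| ≤ C) (hm' : Measurable m') (hC' : ∀ᵐ x ∂ρ, |m' x| ≤ C')
    (h : ∀ x, m x * m' x = 1) (f : L2 ρ) : mulOp hm hC (mulOp hm' hC' f) = f := by
  refine Lp.ext ?_
  filter_upwards [mulOp_apply hm hC (mulOp hm' hC' f), mulOp_apply hm' hC' f] with x h1 h2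
  rw [h1, h2, ← mul_assoc, h, one_mul]

theorem mulOp_comm {m m' : α → ℝ} {C C' : ℝ} (hm : Measurable m)
    (hC : ∀ᵐ x ∂ρ, |m x| ≤ C) (hm' : Measurable m') (hC' : ∀ᵐ x ∂ρ, |m' x| ≤ C') (f : L2 ρ) :
    mulOp hm hC (mulOp hm' hC' f) = mulOp hm' hC' (mulOp hm hC f) := by
  refine Lp.ext ?_
  filter_upwards [mulOp_apply hm hC (mulOp hm' hC' f), mulOp_apply hm' hC' f,
    mulOp_apply hm' hC' (mulOp hm hC f), mulOp_apply hm hC f] with x h1 h2 h3 h4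
  rw [h1, h2, h3, h4]
  ring

end Multiplication

/-! ### Elementary tensors, and linearity of integral operators in the kernel. -/

section Tensor

variable {α β : Type*} [MeasurableSpace α] [MeasurableSpace β] {ρ : Measure α} {ν : Measure β}

theorem memLp_tensor (ψ : L2 ρ) (φ : L2 ν) :
    MemLp (fun p : α × β => ψ p.1 * φ p.2) 2 (ρ.prod ν) := by
  have hm : AEStronglyMeasurable (fun p : α × β => ψ p.1 * φ p.2) (ρ.prod ν) :=
    (Lp.aestronglyMeasurable ψ).comp_fst.mul (Lp.aestronglyMeasurable φ).comp_snd
  rw [memLp_two_iff_integrable_sq hm]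
  simp only [mul_pow]
  exact Integrable.mul_prod (f := fun x => ψ x ^ 2) (g := fun x => φ x ^ 2)
    (Lp.memLp ψ).integrable_sq (Lp.memLp φ).integrable_sq

/-- The elementary tensor `(ψ ⊗ φ)(x, y) = ψ(x) φ(y)`. -/
def tensor (ψ : L2 ρ) (φ : L2 ν) : L2 (ρ.prod ν) := (memLp_tensor ψ φ).toLp _

theorem tensor_apply (ψ : L2 ρ) (φ : L2 ν) :
    tensor ψ φ =ᵐ[ρ.prod ν] fun p => ψ p.1 * φ p.2 := MemLp.coeFn_toLp _

variable [SFinite ρ] [SFinite ν]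

theorem kernelOp_congr {k : L2 (ρ.prod ν)} {g : α × β → ℝ} (h : k =ᵐ[ρ.prod ν] g) (φ : L2 ν) :
    kernelOp k φ =ᵐ[ρ] fun u => ∫ y, g (u, y) * φ y ∂ν := by
  filter_upwards [kernelOp_apply k φ, Measure.ae_ae_of_ae_prod h] with u h1 h2
  rw [h1]
  refine integral_congr_ae ?_
  filter_upwards [h2] with y hy
  rw [hy]

theorem kernelOp_tensor (ψ : L2 ρ) (φ F : L2 ν) :
    kernelOp (tensor ψ φ) F = (inner ℝ φ F : ℝ) • ψ := by
  refine Lp.ext ?_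
  filter_upwards [kernelOp_congr (tensor_apply ψ φ) F, Lp.coeFn_smul (inner ℝ φ F : ℝ) ψ]
    with u h1 h2
  rw [h1, h2, Pi.smul_apply, smul_eq_mul, L2_inner_eq, mul_comm, ← integral_const_mul]
  simp only [mul_assoc]

theorem kernelOp_add_smul (k k' : L2 (ρ.prod ν)) (c : ℝ) (φ : L2 ν) :
    kernelOp (k + c • k') φ = kernelOp k φ + c • kernelOp k' φ := by
  refine Lp.ext ?_
  have h0 : (k + c • k' : L2 (ρ.prod ν)) =ᵐ[ρ.prod ν] fun p => k p + c * k' p := by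
    filter_upwards [Lp.coeFn_add k (c • k'), Lp.coeFn_smul c k'] with p h1 h2
    rw [h1, Pi.add_apply, h2, Pi.smul_apply, smul_eq_mul]
  filter_upwards [kernelOp_congr h0 φ, Lp.coeFn_add (kernelOp k φ) (c • kernelOp k' φ),
    Lp.coeFn_smul c (kernelOp k' φ), kernelOp_apply k φ, kernelOp_apply k' φ,
    slice_integrable k φ, slice_integrable k' φ] with u h1 h2 h3 h4 h5 h6 h7
  rw [h1, h2, Pi.add_apply, h3, Pi.smul_apply, h4, h5, smul_eq_mul, ← integral_const_mul,
    ← integral_add h6 (h7.const_mul c)]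
  congr 1
  ext y
  ring

theorem kernelOp_add (k k' : L2 (ρ.prod ν)) (φ : L2 ν) :
    kernelOp (k + k') φ = kernelOp k φ + kernelOp k' φ := by
  simpa using kernelOp_add_smul k k' 1 φ

theorem kernelOp_smul (c : ℝ) (k : L2 (ρ.prod ν)) (φ : L2 ν) :
    kernelOp (c • k) φ = c • kernelOp k φ := by
  have h0 : kernelOp (0 : L2 (ρ.prod ν)) φ = 0 := by
    simpa using kernelOp_add (0 : L2 (ρ.prod ν)) 0 φ
  simpa [h0] using kernelOp_add_smul 0 k c φ

theorem kernelOp_norm_le (k : L2 (ρ.prod ν)) (φ : L2 ν) : ‖kernelOp k φ‖ ≤ ‖k‖ * ‖φ‖ := by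
  refine (kernelOp k).le_of_opNorm_le ?_ φ
  exact LinearMap.mkContinuous_norm_le _ (norm_nonneg _) _

end Tensor

/-! ### Integration over (0, T) and its adjoint. -/

section TimeIntegral

variable {α : Type*} [MeasurableSpace α] {ρ : Measure α} [IsFiniteMeasure ρ] {T : ℝ}

/-- The indicator function of `(0, t)` in `L²(0, T)`. -/
def timeInd (T t : ℝ) : L2 (timeMeasure T) :=
  indicatorConstLp 2 (measurableSet_Iio (a := t)) (measure_ne_top _ _) (1 : ℝ)

theorem timeInd_apply (T t : ℝ) :
    timeInd T t =ᵐ[timeMeasure T] fun r => if r < t then 1 else 0 := by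
  filter_upwards [indicatorConstLp_coeFn (p := 2) (hs := measurableSet_Iio (a := t))
    (hμs := measure_ne_top (timeMeasure T) _) (c := (1 : ℝ))] with r h
  rw [timeInd, h, indicator_apply]
  rfl

/-- Integration over the time interval, `(R v)(y) = ∫₀ᵀ v(y, s) ds`. -/
def timeIntegral (ρ : Measure α) [IsFiniteMeasure ρ] (T : ℝ) :
    L2 (ρ.prod (timeMeasure T)) →L[ℝ] L2 ρ :=
  LinearMap.mkContinuous
    { toFun := fun v => kernelOp v (timeInd T T)
      map_add' := fun v v' => kernelOp_add v v' _
      map_smul' := fun c v => kernelOp_smul c v _ }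
    ‖timeInd T T‖ (fun v => (kernelOp_norm_le v _).trans_eq (mul_comm _ _))

theorem kernelOp_timeInd (v : L2 (ρ.prod (timeMeasure T))) (t : ℝ) :
    kernelOp v (timeInd T t) =ᵐ[ρ]
      fun y => ∫ r, (if r < t then 1 else 0) * v (y, r) ∂(timeMeasure T) := by
  filter_upwards [kernelOp_apply v (timeInd T t)] with y h
  rw [h]
  refine integral_congr_ae ?_
  filter_upwards [timeInd_apply T t] with r hr
  rw [hr, mul_comm]

theorem timeIntegral_apply (v : L2 (ρ.prod (timeMeasure T))) :
    timeIntegral ρ T v =ᵐ[ρ] fun y => ∫ r, v (y, r) ∂(timeMeasure T) := by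
  filter_upwards [kernelOp_timeInd v T] with y h
  change kernelOp v (timeInd T T) y = _
  rw [h]
  refine integral_congr_ae ?_
  filter_upwards [ae_restrict_mem measurableSet_Ioo] with r hr
  rw [if_pos hr.2, one_mul]

/-- A function of `y`, considered as a function of `(y, s)`. -/
def timeConst (T : ℝ) (φ : L2 ρ) : L2 (ρ.prod (timeMeasure T)) := tensor φ (timeInd T T)

theorem timeConst_apply (φ : L2 ρ) :
    timeConst T φ =ᵐ[ρ.prod (timeMeasure T)] fun p => φ p.1 := by
  have h : ∀ᵐ p ∂(ρ.prod (timeMeasure T)), timeInd T T p.2 = 1 := by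
    refine (Measure.quasiMeasurePreserving_snd (μ := ρ) (ν := timeMeasure T)).ae (p := fun r => timeInd T T r = 1) ?_
    filter_upwards [timeInd_apply T T, ae_restrict_mem measurableSet_Ioo] with r h1 h2
    rw [h1, if_pos h2.2]
  filter_upwards [tensor_apply φ (timeInd T T), h] with p h1 h2
  rw [timeConst, h1, h2, mul_one]

/-- Fubini. That the adjoint produces functions constant in time is what unique continuation
exploits: such a function is determined by its values near s = 0. -/
theorem adjoint_timeIntegral (φ : L2 ρ) :
    ContinuousLinearMap.adjoint (timeIntegral ρ T) φ = timeConst T φ := by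
  refine ext_inner_left ℝ fun v => ?_
  rw [ContinuousLinearMap.adjoint_inner_right, L2_inner_eq, L2_inner_eq]
  have hint : Integrable (fun p : α × ℝ => v p * timeConst T φ p) (ρ.prod (timeMeasure T)) :=
    (Lp.memLp v).integrable_mul (Lp.memLp _)
  rw [integral_prod _ hint]
  refine integral_congr_ae ?_
  filter_upwards [timeIntegral_apply v, Measure.ae_ae_of_ae_prod (timeConst_apply (T := T) φ)]
    with y h1 h2
  rw [h1, ← integral_mul_const]
  refine integral_congr_ae ?_
  filter_upwards [h2] with r hr
  rw [hr]

end TimeIntegral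

/-- A measurable function of two time variables with values in `[-1, 1]`. -/
structure TimeKernel where
  toFun : ℝ → ℝ → ℝ
  measurable : Measurable (Function.uncurry toFun)
  abs_le_one : ∀ s r, |toFun s r| ≤ 1

/-! ### Constant, causal and anticausal time kernels. -/

namespace TimeKernel

/-- The constant kernel `1`. -/
def one : TimeKernel := ⟨fun _ _ => 1, measurable_const, by simp⟩

/-- The damped causal kernel `𝟙(r < s) exp(-γ |s - r|)`. -/
def causal (γ : ℝ≥0) : TimeKernel where
  toFun s r := if r < s then Real.exp (-(γ * |s - r|)) else 0
  measurable := by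
    refine Measurable.ite (measurableSet_lt measurable_snd measurable_fst) ?_ measurable_const
    fun_prop
  abs_le_one s r := by
    split_ifs
    · rw [abs_of_pos (Real.exp_pos _), Real.exp_le_one_iff]
      have : 0 ≤ (γ : ℝ) * |s - r| := by positivity
      linarith
    · simp

/-- The damped anticausal kernel `𝟙(s ≤ r) exp(-γ |s - r|)`. -/
def anticausal (γ : ℝ≥0) : TimeKernel where
  toFun s r := if r < s then 0 else Real.exp (-(γ * |s - r|))
  measurable := by
    refine Measurable.ite (measurableSet_lt measurable_snd measurable_fst) measurable_const ?_
    fun_prop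
  abs_le_one s r := by
    split_ifs
    · simp
    · rw [abs_of_pos (Real.exp_pos _), Real.exp_le_one_iff]
      have : 0 ≤ (γ : ℝ) * |s - r| := by positivity
      linarith

theorem abs_causal_le (γ : ℝ≥0) (s r : ℝ) :
    |(causal γ).toFun s r| ≤ Real.exp (-(γ * |s - r|)) := by
  simp only [causal]
  split_ifs
  · rw [abs_of_pos (Real.exp_pos _)]
  · simpa using (Real.exp_pos _).le

theorem abs_anticausal_le (γ : ℝ≥0) (s r : ℝ) :
    |(anticausal γ).toFun s r| ≤ Real.exp (-(γ * |s - r|)) := by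
  simp only [anticausal]
  split_ifs
  · simpa using (Real.exp_pos _).le
  · rw [abs_of_pos (Real.exp_pos _)]

end TimeKernel

/-! ### Volterra-type operators with weight b and their Hilbert-Schmidt bounds. -/

section Volterra

variable {α : Type*} [MeasurableSpace α] {ρ : Measure α} [IsFiniteMeasure ρ] {T : ℝ}

/-- Weights are stored in the order (y, z, s), whereas the operators freeze (y, s) and integrate
over z. -/
theorem measurePreserving_rearrange {β : Type*} [MeasurableSpace β] (τ : Measure β) [SFinite τ] :
    MeasurePreserving (fun p : (α × β) × α => (p.1.1, (p.2, p.1.2)))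
      ((ρ.prod τ).prod ρ) (ρ.prod (ρ.prod τ)) := by
  have h1 := measurePreserving_prodAssoc ρ τ ρ
  have h2 : MeasurePreserving (Prod.map id Prod.swap) (ρ.prod (τ.prod ρ)) (ρ.prod (ρ.prod τ)) :=
    (MeasurePreserving.id ρ).prod Measure.measurePreserving_swap
  exact h2.comp h1

theorem ae_slice {P : α × α × ℝ → Prop}
    (h : ∀ᵐ x ∂(ρ.prod (ρ.prod (timeMeasure T))), P x) :
    ∀ᵐ p ∂(ρ.prod (timeMeasure T)), ∀ᵐ z ∂ρ, P (p.1, z, p.2) :=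
  Measure.ae_ae_of_ae_prod
    ((measurePreserving_rearrange (timeMeasure T)).quasiMeasurePreserving.ae h)

theorem weight_slice_memLp (b : L2 (ρ.prod (ρ.prod (timeMeasure T)))) :
    ∀ᵐ p ∂(ρ.prod (timeMeasure T)), MemLp (fun z => b (p.1, z, p.2)) 2 ρ := by
  have h := (Lp.memLp b).comp_measurePreserving
    (measurePreserving_rearrange (ρ := ρ) (timeMeasure T))
  filter_upwards [slice_memLp (h.toLp _), Measure.ae_ae_of_ae_prod h.coeFn_toLp] with p h1 h2
  exact (memLp_congr_ae h2).1 h1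

theorem measurePreserving_rearrange_four :
    MeasurePreserving (fun p : (α × ℝ) × (α × ℝ) => ((p.1.1, (p.2.1, p.1.2)), p.2.2))
      ((ρ.prod (timeMeasure T)).prod (ρ.prod (timeMeasure T)))
      ((ρ.prod (ρ.prod (timeMeasure T))).prod (timeMeasure T)) := by
  have h1 := (measurePreserving_prodAssoc (ρ.prod (timeMeasure T)) ρ (timeMeasure T)).symm
    (MeasurableEquiv.prodAssoc)
  have h2 := (measurePreserving_rearrange (ρ := ρ) (timeMeasure T)).prod
    (MeasurePreserving.id (timeMeasure T))
  exact h2.comp h1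

/-- Hilbert-Schmidt norm of the kernel b(y, z, s) θ(s, r): the weight does not depend on r, so
integrating over r first costs only the uniform bound C. -/
theorem eLpNorm_weight_mul_le (b : L2 (ρ.prod (ρ.prod (timeMeasure T)))) (θ : TimeKernel)
    {C : ℝ≥0∞} (hC : ∀ s, ∫⁻ r, ‖θ.toFun s r‖ₑ ^ (2 : ℝ) ∂(timeMeasure T) ≤ C) :
    eLpNorm (fun p : (α × ℝ) × (α × ℝ) => b (p.1.1, p.2.1, p.1.2) * θ.toFun p.1.2 p.2.2) 2
      ((ρ.prod (timeMeasure T)).prod (ρ.prod (timeMeasure T))) ≤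
      ENNReal.ofReal ‖b‖ * C ^ (1 / 2 : ℝ) := by
  have hθ : Measurable fun p : (α × α × ℝ) × ℝ => θ.toFun p.1.2.2 p.2 :=
    θ.measurable.comp (measurable_fst.snd.snd.prodMk measurable_snd)
  have hm : Measurable fun p : (α × α × ℝ) × ℝ => b p.1 * θ.toFun p.1.2.2 p.2 :=
    ((Lp.stronglyMeasurable b).measurable.comp measurable_fst).mul hθ
  have h := eLpNorm_comp_measurePreserving (p := 2) hm.aestronglyMeasurable
    (measurePreserving_rearrange_four (ρ := ρ) (T := T))
  refine (le_of_eq h).trans ?_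
  rw [Lp.norm_def, ENNReal.ofReal_toReal (Lp.eLpNorm_ne_top b), eLpNorm_two_eq, eLpNorm_two_eq,
    ← ENNReal.mul_rpow_of_nonneg _ _ (by norm_num)]
  refine ENNReal.rpow_le_rpow ?_ (by norm_num)
  rw [lintegral_prod _ (hm.enorm.pow_const _).aemeasurable,
    ← lintegral_mul_const _ ((Lp.stronglyMeasurable b).measurable.enorm.pow_const _)]
  refine lintegral_mono fun x => ?_
  simp only [enorm_mul, ENNReal.mul_rpow_of_nonneg _ _ (zero_le_two (α := ℝ))]
  rw [lintegral_const_mul]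
  · exact mul_le_mul_right (hC _) _
  · exact ((θ.measurable.comp measurable_prodMk_left).enorm.pow_const _)

theorem lintegral_timeKernel_le (θ : TimeKernel) (s : ℝ) :
    ∫⁻ r, ‖θ.toFun s r‖ₑ ^ (2 : ℝ) ∂(timeMeasure T) ≤ timeMeasure T univ := by
  rw [← lintegral_one]
  refine lintegral_mono fun r => ?_
  refine ENNReal.rpow_le_one ?_ (by norm_num)
  rw [← ofReal_norm, ENNReal.ofReal_le_one]
  exact θ.abs_le_one s r

theorem memLp_weight_mul (b : L2 (ρ.prod (ρ.prod (timeMeasure T)))) (θ : TimeKernel) :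
    MemLp (fun p : (α × ℝ) × (α × ℝ) => b (p.1.1, p.2.1, p.1.2) * θ.toFun p.1.2 p.2.2) 2
      ((ρ.prod (timeMeasure T)).prod (ρ.prod (timeMeasure T))) := by
  refine ⟨?_, (eLpNorm_weight_mul_le b θ (lintegral_timeKernel_le θ)).trans_lt ?_⟩
  · refine Measurable.aestronglyMeasurable ?_
    have hθ : Measurable fun p : (α × ℝ) × (α × ℝ) => θ.toFun p.1.2 p.2.2 :=
      θ.measurable.comp (measurable_fst.snd.prodMk measurable_snd.snd)
    exact ((Lp.stronglyMeasurable b).measurable.comp (by fun_prop)).mul hθ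
  · exact ENNReal.mul_lt_top ENNReal.ofReal_lt_top
      (ENNReal.rpow_lt_top_of_nonneg (by norm_num) (measure_ne_top _ _))

/-- The Volterra-type operator `(V v)(y, s) = ∫ b(y, z, s) ∫ θ(s, r) v(z, r) dr dz`. -/
def volterra (b : L2 (ρ.prod (ρ.prod (timeMeasure T)))) (θ : TimeKernel) :
    L2 (ρ.prod (timeMeasure T)) →L[ℝ] L2 (ρ.prod (timeMeasure T)) :=
  kernelOp ((memLp_weight_mul b θ).toLp _)

theorem volterra_apply (b : L2 (ρ.prod (ρ.prod (timeMeasure T)))) (θ : TimeKernel)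
    (v : L2 (ρ.prod (timeMeasure T))) :
    volterra b θ v =ᵐ[ρ.prod (timeMeasure T)] fun p =>
      ∫ z, b (p.1, z, p.2) * ∫ r, θ.toFun p.2 r * v (z, r) ∂(timeMeasure T) ∂ρ := by
  have hk := (memLp_weight_mul b θ).coeFn_toLp
  filter_upwards [kernelOp_congr hk v, slice_integrable ((memLp_weight_mul b θ).toLp _) v,
    Measure.ae_ae_of_ae_prod hk] with p h1 h2 h3
  rw [volterra, h1]
  have h4 : Integrable (fun q : α × ℝ => b (p.1, q.1, p.2) * θ.toFun p.2 q.2 * v q)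
      (ρ.prod (timeMeasure T)) := by
    refine h2.congr ?_
    filter_upwards [h3] with q hq
    rw [hq]
  rw [integral_prod _ h4]
  refine integral_congr_ae (Filter.Eventually.of_forall fun z => ?_)
  simp only [mul_assoc]
  rw [integral_const_mul]

theorem volterra_slice_integrable (b : L2 (ρ.prod (ρ.prod (timeMeasure T)))) (θ : TimeKernel)
    (v : L2 (ρ.prod (timeMeasure T))) :
    ∀ᵐ p ∂(ρ.prod (timeMeasure T)),
      Integrable (fun z => b (p.1, z, p.2) * ∫ r, θ.toFun p.2 r * v (z, r) ∂(timeMeasure T)) ρ := by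
  have hk := (memLp_weight_mul b θ).coeFn_toLp
  filter_upwards [slice_integrable ((memLp_weight_mul b θ).toLp _) v,
    Measure.ae_ae_of_ae_prod hk] with p h2 h3
  have h4 : Integrable (fun q : α × ℝ => b (p.1, q.1, p.2) * θ.toFun p.2 q.2 * v q)
      (ρ.prod (timeMeasure T)) := by
    refine h2.congr ?_
    filter_upwards [h3] with q hq
    rw [hq]
  refine h4.integral_prod_left.congr (Filter.Eventually.of_forall fun z => ?_)
  simp only [mul_assoc]
  rw [integral_const_mul]

theorem volterra_congr {b : L2 (ρ.prod (ρ.prod (timeMeasure T)))} {g : α × α × ℝ → ℝ}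
    (h : b =ᵐ[ρ.prod (ρ.prod (timeMeasure T))] g) (θ : TimeKernel)
    (v : L2 (ρ.prod (timeMeasure T))) :
    volterra b θ v =ᵐ[ρ.prod (timeMeasure T)] fun p =>
      ∫ z, g (p.1, z, p.2) * ∫ r, θ.toFun p.2 r * v (z, r) ∂(timeMeasure T) ∂ρ := by
  filter_upwards [volterra_apply b θ v, ae_slice h] with p h1 h2
  rw [h1]
  refine integral_congr_ae ?_
  filter_upwards [h2] with z hz
  rw [hz]

theorem volterra_add_smul (b β : L2 (ρ.prod (ρ.prod (timeMeasure T)))) (c : ℝ) (θ : TimeKernel)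
    (v : L2 (ρ.prod (timeMeasure T))) :
    volterra (b + c • β) θ v = volterra b θ v + c • volterra β θ v := by
  refine Lp.ext ?_
  have h0 : (b + c • β : L2 (ρ.prod (ρ.prod (timeMeasure T)))) =ᵐ[ρ.prod (ρ.prod (timeMeasure T))]
      fun p => b p + c * β p := by
    filter_upwards [Lp.coeFn_add b (c • β), Lp.coeFn_smul c β] with p h1 h2
    rw [h1, Pi.add_apply, h2, Pi.smul_apply, smul_eq_mul]
  filter_upwards [volterra_congr h0 θ v, Lp.coeFn_add (volterra b θ v) (c • volterra β θ v),
    Lp.coeFn_smul c (volterra β θ v), volterra_apply b θ v, volterra_apply β θ v,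
    volterra_slice_integrable b θ v, volterra_slice_integrable β θ v] with u h1 h2 h3 h4 h5 h6 h7
  rw [h1, h2, Pi.add_apply, h3, Pi.smul_apply, h4, h5, smul_eq_mul, ← integral_const_mul,
    ← integral_add h6 (h7.const_mul c)]
  congr 1
  ext y
  ring

theorem volterra_norm_le_of_lintegral (b : L2 (ρ.prod (ρ.prod (timeMeasure T)))) (θ : TimeKernel)
    {C : ℝ≥0} (hC : ∀ s, ∫⁻ r, ‖θ.toFun s r‖ₑ ^ (2 : ℝ) ∂(timeMeasure T) ≤ C)
    (v : L2 (ρ.prod (timeMeasure T))) :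
    ‖volterra b θ v‖ ≤ ‖b‖ * (C : ℝ) ^ (1 / 2 : ℝ) * ‖v‖ := by
  refine (kernelOp_norm_le _ v).trans (mul_le_mul_of_nonneg_right ?_ (norm_nonneg _))
  rw [Lp.norm_toLp]
  refine (ENNReal.toReal_mono ?_ (eLpNorm_weight_mul_le b θ hC)).trans_eq ?_
  · exact ENNReal.mul_ne_top ENNReal.ofReal_ne_top
      (ENNReal.rpow_ne_top_of_nonneg (by norm_num) ENNReal.coe_ne_top)
  · rw [ENNReal.toReal_mul, ENNReal.toReal_ofReal (norm_nonneg _), ← ENNReal.toReal_rpow,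
      ENNReal.coe_toReal]

theorem integrable_timeKernel_mul (θ : TimeKernel) (v : L2 (ρ.prod (timeMeasure T))) :
    ∀ᵐ z ∂ρ, ∀ s, Integrable (fun r => θ.toFun s r * v (z, r)) (timeMeasure T) := by
  filter_upwards [slice_memLp v] with z hz s
  refine (hz.integrable (by norm_num)).bdd_mul (c := 1) ?_ ?_
  · exact (θ.measurable.comp measurable_prodMk_left).aestronglyMeasurable
  · exact Filter.Eventually.of_forall fun r => θ.abs_le_one s r

theorem volterra_add_kernel (b : L2 (ρ.prod (ρ.prod (timeMeasure T)))) (θ θ' θ'' : TimeKernel)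
    (h : ∀ s r, θ.toFun s r + θ'.toFun s r = θ''.toFun s r) (v : L2 (ρ.prod (timeMeasure T))) :
    volterra b θ v + volterra b θ' v = volterra b θ'' v := by
  refine Lp.ext ?_
  filter_upwards [volterra_apply b θ v, volterra_apply b θ' v, volterra_apply b θ'' v,
    Lp.coeFn_add (volterra b θ v) (volterra b θ' v), volterra_slice_integrable b θ v,
    volterra_slice_integrable b θ' v] with p h1 h2 h3 h4 h5 h6
  rw [h4, Pi.add_apply, h1, h2, h3, ← integral_add h5 h6]
  refine integral_congr_ae ?_
  filter_upwards [integrable_timeKernel_mul θ v, integrable_timeKernel_mul θ' v] with z hz hz'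
  rw [← mul_add, ← integral_add (hz _) (hz' _)]
  congr 2
  ext r
  rw [← add_mul, h]

/-- Changing `v` and the time kernel simultaneously does not change the operator. -/
theorem mulOp_volterra_eq {m : ℝ → ℝ} {C : ℝ} (hm : Measurable fun p : α × ℝ => m p.2)
    (hC : ∀ᵐ p ∂(ρ.prod (timeMeasure T)), |m p.2| ≤ C)
    (b : L2 (ρ.prod (ρ.prod (timeMeasure T)))) (θ θ' : TimeKernel)
    {m' : ℝ → ℝ} {C' : ℝ} (hm' : Measurable fun p : α × ℝ => m' p.2)
    (hC' : ∀ᵐ p ∂(ρ.prod (timeMeasure T)), |m' p.2| ≤ C')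
    (h : ∀ s r, m s * θ.toFun s r = θ'.toFun s r * m' r) (v : L2 (ρ.prod (timeMeasure T))) :
    mulOp hm hC (volterra b θ v) = volterra b θ' (mulOp hm' hC' v) := by
  refine Lp.ext ?_
  filter_upwards [mulOp_apply hm hC (volterra b θ v), volterra_apply b θ v,
    volterra_apply b θ' (mulOp hm' hC' v)] with p h1 h2 h3
  rw [h1, h2, h3, ← integral_const_mul]
  refine integral_congr_ae ?_
  filter_upwards [Measure.ae_ae_of_ae_prod (mulOp_apply hm' hC' v)] with z hz
  rw [mul_left_comm, ← integral_const_mul]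
  congr 1
  refine integral_congr_ae ?_
  filter_upwards [hz] with r hr
  rw [hr, ← mul_assoc, ← mul_assoc, h]

/-- Enlarging (0, T) to the whole line gives ∫ exp(-2γ|x|) dx = 1/γ, uniformly in s; this is the
gain that makes damped operators small. -/
theorem lintegral_exp_abs_le {γ : ℝ≥0} (hγ : 0 < γ) (s : ℝ) :
    ∫⁻ r, ‖Real.exp (-(γ * |s - r|))‖ₑ ^ (2 : ℝ) ∂(timeMeasure T) ≤ (γ⁻¹ : ℝ≥0) := by
  have hγ' : (0 : ℝ) < γ := hγ
  have e : ∀ r, ‖Real.exp (-(γ * |s - r|))‖ₑ ^ (2 : ℝ) =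
      ENNReal.ofReal (Real.exp (-(2 * γ) * |s - r|)) := by
    intro r
    rw [← ofReal_norm, Real.norm_of_nonneg (Real.exp_pos _).le,
      ENNReal.ofReal_rpow_of_pos (Real.exp_pos _), ← Real.exp_mul]
    congr 2
    ring
  simp only [e]
  refine (lintegral_mono' Measure.restrict_le_self le_rfl).trans ?_
  rw [lintegral_sub_left_eq_self (fun x => ENNReal.ofReal (Real.exp (-(2 * γ) * |x|))) s]
  have h0 : ∫ x in Ioi (0 : ℝ), Real.exp (-(2 * γ) * x) = 1 / (2 * γ) := by
    rw [integral_exp_mul_Ioi (by linarith)]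
    simp
  have h1 : ∫ x : ℝ, Real.exp (-(2 * γ) * |x|) = (γ : ℝ)⁻¹ := by
    rw [integral_comp_abs (f := fun x => Real.exp (-(2 * γ) * x)), h0]
    field_simp
  have hi : Integrable fun x : ℝ => Real.exp (-(2 * γ) * |x|) := by
    by_contra hni
    rw [integral_undef hni] at h1
    exact (inv_pos.2 hγ').ne h1
  rw [← ofReal_integral_eq_lintegral_ofReal hi
    (Filter.Eventually.of_forall fun x => (Real.exp_pos _).le), h1, ← NNReal.coe_inv,
    ENNReal.ofReal_coe_nnreal]

theorem volterra_norm_le_of_exp (b : L2 (ρ.prod (ρ.prod (timeMeasure T)))) (θ : TimeKernel)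
    {γ : ℝ≥0} (hγ : 0 < γ) (hθ : ∀ s r, |θ.toFun s r| ≤ Real.exp (-(γ * |s - r|)))
    (v : L2 (ρ.prod (timeMeasure T))) :
    ‖volterra b θ v‖ ≤ ‖b‖ * ((γ⁻¹ : ℝ≥0) : ℝ) ^ (1 / 2 : ℝ) * ‖v‖ := by
  refine volterra_norm_le_of_lintegral b θ (fun s => ?_) v
  refine (lintegral_mono fun r => ?_).trans (lintegral_exp_abs_le hγ s)
  refine ENNReal.rpow_le_rpow ?_ (by norm_num)
  rw [enorm_le_iff_norm_le, Real.norm_of_nonneg (Real.exp_pos _).le]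
  exact hθ s r

/-- The operators with strongly damped time kernel are small. -/
theorem exists_damping (b : L2 (ρ.prod (ρ.prod (timeMeasure T)))) {ε : ℝ} (hε : 0 < ε) :
    ∃ γ₀ : ℝ≥0, ∀ γ : ℝ≥0, γ₀ ≤ γ → ∀ θ : TimeKernel,
      (∀ s r, |θ.toFun s r| ≤ Real.exp (-(γ * |s - r|))) →
      ∀ v : L2 (ρ.prod (timeMeasure T)), ‖volterra b θ v‖ ≤ ε * ‖v‖ := by
  have h1 : Filter.Tendsto (fun γ : ℝ≥0 => ‖b‖ * ((γ⁻¹ : ℝ≥0) : ℝ) ^ (1 / 2 : ℝ)) Filter.atTop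
      (nhds (‖b‖ * (0 : ℝ) ^ (1 / 2 : ℝ))) := by
    refine Filter.Tendsto.const_mul _ (Filter.Tendsto.rpow_const ?_ (Or.inr (by norm_num)))
    exact (NNReal.tendsto_coe.2 tendsto_inv_atTop_zero)
  rw [Real.zero_rpow (by norm_num), mul_zero] at h1
  obtain ⟨γ₀, h⟩ := Filter.eventually_atTop.1
    ((h1.eventually_le_const hε).and (Filter.eventually_gt_atTop 0))
  refine ⟨γ₀, fun γ hγ θ hθ v => ?_⟩
  exact (volterra_norm_le_of_exp b θ (h γ hγ).2 hθ v).trans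
    (mul_le_mul_of_nonneg_right (h γ hγ).1 (norm_nonneg _))

end Volterra

/-! ### Exponential weights in time. -/

section ExpWeight

variable {α : Type*} [MeasurableSpace α] {ρ : Measure α} [IsFiniteMeasure ρ] {T : ℝ}

theorem ae_time_mem : ∀ᵐ p ∂(ρ.prod (timeMeasure T)), p.2 ∈ Ioo 0 T :=
  (Measure.quasiMeasurePreserving_snd (μ := ρ) (ν := timeMeasure T)).ae
    (p := fun r => r ∈ Ioo 0 T) (ae_restrict_mem measurableSet_Ioo)

theorem measurable_exp_time (γ : ℝ) : Measurable fun p : α × ℝ => Real.exp (γ * p.2) := by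
  fun_prop

theorem ae_exp_time_le (γ : ℝ) :
    ∀ᵐ p ∂(ρ.prod (timeMeasure T)), |Real.exp (γ * p.2)| ≤ Real.exp (|γ| * T) := by
  filter_upwards [ae_time_mem (ρ := ρ) (T := T)] with p hp
  rw [abs_of_pos (Real.exp_pos _), Real.exp_le_exp]
  calc γ * p.2 ≤ |γ| * p.2 := mul_le_mul_of_nonneg_right (le_abs_self γ) hp.1.le
    _ ≤ |γ| * T := mul_le_mul_of_nonneg_left hp.2.le (abs_nonneg γ)

/-- Multiplication by `exp(γ s)` on functions of `(y, s)`. -/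
def expWeight (ρ : Measure α) [IsFiniteMeasure ρ] (T γ : ℝ) :
    L2 (ρ.prod (timeMeasure T)) →L[ℝ] L2 (ρ.prod (timeMeasure T)) :=
  mulOp (measurable_exp_time γ) (ae_exp_time_le γ)

theorem expWeight_neg_apply (γ : ℝ) (v : L2 (ρ.prod (timeMeasure T))) :
    expWeight ρ T (-γ) (expWeight ρ T γ v) = v :=
  mulOp_mulOp_eq_self _ _ _ _ (fun p => by rw [← Real.exp_add]; simp) v

theorem expWeight_apply_neg (γ : ℝ) (v : L2 (ρ.prod (timeMeasure T))) :
    expWeight ρ T γ (expWeight ρ T (-γ) v) = v :=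
  mulOp_mulOp_eq_self _ _ _ _ (fun p => by rw [← Real.exp_add]; simp) v

theorem isUnit_expWeight (γ : ℝ) : IsUnit (expWeight ρ T γ) :=
  ⟨⟨expWeight ρ T γ, expWeight ρ T (-γ), ContinuousLinearMap.ext fun v => expWeight_apply_neg γ v,
    ContinuousLinearMap.ext fun v => expWeight_neg_apply γ v⟩, rfl⟩

/-- For r < s, exp(-γs) = exp(-γ|s - r|) exp(-γr). Conjugation by the weight thus turns the undamped
causal kernel into the damped one, so smallness is obtained in a weighted norm. -/
theorem expWeight_causal (b : L2 (ρ.prod (ρ.prod (timeMeasure T)))) (γ : ℝ≥0)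
    (v : L2 (ρ.prod (timeMeasure T))) :
    expWeight ρ T (-γ) (volterra b (TimeKernel.causal 0) v) =
      volterra b (TimeKernel.causal γ) (expWeight ρ T (-γ) v) := by
  refine mulOp_volterra_eq (m := fun s => Real.exp (-γ * s)) (m' := fun s => Real.exp (-γ * s))
    _ _ _ _ _ _ _ (fun s r => ?_) v
  simp only [TimeKernel.causal]
  split_ifs with h
  · rw [← Real.exp_add, ← Real.exp_add, abs_of_pos (sub_pos.2 h)]
    congr 1
    push_cast
    ring
  · simp

/-- The weight needs the opposite sign here, because the kernel lives on r ≥ s. -/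
theorem expWeight_anticausal (b : L2 (ρ.prod (ρ.prod (timeMeasure T)))) (γ : ℝ≥0)
    (v : L2 (ρ.prod (timeMeasure T))) :
    expWeight ρ T γ (volterra b (TimeKernel.anticausal 0) v) =
      volterra b (TimeKernel.anticausal γ) (expWeight ρ T γ v) := by
  refine mulOp_volterra_eq (m := fun s => Real.exp (γ * s)) (m' := fun s => Real.exp (γ * s))
    _ _ _ _ _ _ _ (fun s r => ?_) v
  simp only [TimeKernel.anticausal]
  split_ifs with h
  · simp
  · rw [← Real.exp_add, ← Real.exp_add, abs_of_nonpos (sub_nonpos.2 (not_lt.1 h))]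
    congr 1
    push_cast
    ring

end ExpWeight

/-! ### The weight b acting on a single state. -/

section StateOp

variable {α : Type*} [MeasurableSpace α] {ρ : Measure α} [IsFiniteMeasure ρ] {T : ℝ}

/-- The operator `(C φ)(y, s) = ∫ b(y, z, s) φ(z) dz`. -/
def stateOp (b : L2 (ρ.prod (ρ.prod (timeMeasure T)))) : L2 ρ →L[ℝ] L2 (ρ.prod (timeMeasure T)) :=
  -- The adjoint of `timeIntegral` extends φ constantly in time; integrating it over (0, T) again
  -- gives Tφ, whence the factor T⁻¹.
  T⁻¹ • (volterra b TimeKernel.one).comp (ContinuousLinearMap.adjoint (timeIntegral ρ T))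

theorem stateOp_apply (hT : 0 < T) (b : L2 (ρ.prod (ρ.prod (timeMeasure T)))) (φ : L2 ρ) :
    stateOp b φ =ᵐ[ρ.prod (timeMeasure T)] fun p => ∫ z, b (p.1, z, p.2) * φ z ∂ρ := by
  have e : stateOp b φ = T⁻¹ • volterra b TimeKernel.one (timeConst T φ) := by
    rw [← adjoint_timeIntegral]
    rfl
  rw [e]
  filter_upwards [Lp.coeFn_smul T⁻¹ (volterra b TimeKernel.one (timeConst T φ)),
    volterra_apply b TimeKernel.one (timeConst T φ)] with p h1 h2
  rw [h1, Pi.smul_apply, h2, smul_eq_mul, ← integral_const_mul]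
  refine integral_congr_ae ?_
  filter_upwards [Measure.ae_ae_of_ae_prod (timeConst_apply (T := T) φ)] with z hz
  have : ∫ r, TimeKernel.one.toFun p.2 r * timeConst T φ (z, r) ∂(timeMeasure T) = T * φ z := by
    have e2 : ∫ r, TimeKernel.one.toFun p.2 r * timeConst T φ (z, r) ∂(timeMeasure T) =
        ∫ r, φ z ∂(timeMeasure T) := by
      refine integral_congr_ae ?_
      filter_upwards [hz] with r hr
      rw [hr, TimeKernel.one, one_mul]
    rw [e2, integral_const]
    simp [hT.le]
  rw [this]
  field_simp

theorem stateOp_add_smul (b β : L2 (ρ.prod (ρ.prod (timeMeasure T)))) (c : ℝ) (φ : L2 ρ) :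
    stateOp (b + c • β) φ = stateOp b φ + c • stateOp β φ := by
  simp only [stateOp, smul_apply, ContinuousLinearMap.comp_apply,
    volterra_add_smul, smul_add]
  rw [smul_comm]

/-- Without a causal cutoff the inner integral is the full time integral of v, so the operator
factors through L²(ρ). This factorization later isolates a time-constant term in the adjoint
equation. -/
theorem volterra_one_apply (hT : 0 < T) (b : L2 (ρ.prod (ρ.prod (timeMeasure T))))
    (v : L2 (ρ.prod (timeMeasure T))) :
    volterra b TimeKernel.one v = stateOp b (timeIntegral ρ T v) := by
  refine Lp.ext ?_
  filter_upwards [stateOp_apply hT b (timeIntegral ρ T v), volterra_apply b TimeKernel.one v]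
    with p h1 h2
  rw [h1, h2]
  refine integral_congr_ae ?_
  filter_upwards [timeIntegral_apply v] with z hz
  rw [hz]
  simp [TimeKernel.one]

theorem state_slice_integrable (b : L2 (ρ.prod (ρ.prod (timeMeasure T)))) (φ : L2 ρ) :
    ∀ᵐ p ∂(ρ.prod (timeMeasure T)), Integrable (fun z => b (p.1, z, p.2) * φ z) ρ := by
  filter_upwards [weight_slice_memLp b] with p hp
  exact hp.integrable_mul (Lp.memLp φ)

end StateOp

/-! ### The superposition operator of σ. -/

section Nemytskii

variable {α : Type*} [MeasurableSpace α] {ρ : Measure α} [IsFiniteMeasure ρ]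
  {σ : ℝ → ℝ} {L : ℝ≥0}

theorem memLp_comp_of_lipschitzWith (hσ : LipschitzWith L σ) {X : α → ℝ}
    (hX : MemLp X 2 ρ) : MemLp (fun x => σ (X x)) 2 ρ := by
  have h0 : LipschitzWith L fun x => σ x - σ 0 := by
    simpa using hσ.sub (LipschitzWith.const (σ 0))
  have h1 := (h0.comp_memLp (by simp) hX).add (memLp_const (σ 0))
  refine h1.ae_eq (Filter.Eventually.of_forall fun x => ?_)
  simp

/-- The superposition operator `X ↦ σ ∘ X` on `L²`. -/
def nemytskii (hσ : LipschitzWith L σ) (X : L2 ρ) : L2 ρ :=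
  (memLp_comp_of_lipschitzWith hσ (Lp.memLp X)).toLp _

theorem nemytskii_apply (hσ : LipschitzWith L σ) (X : L2 ρ) :
    nemytskii hσ X =ᵐ[ρ] fun x => σ (X x) := MemLp.coeFn_toLp _

theorem abs_sub_le_of_lipschitz (hσ : LipschitzWith L σ) (x y : ℝ) :
    |σ x - σ y| ≤ L * |x - y| := by
  simpa [Real.dist_eq] using hσ.dist_le_mul x y

/-- The Lipschitz estimate is pointwise, hence it holds with the same constant after multiplication
by any weight, in particular exp(-γs). -/
theorem mulOp_nemytskii_sub_le (hσ : LipschitzWith L σ) {m : α → ℝ} {C : ℝ} (hm : Measurable m)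
    (hC : ∀ᵐ x ∂ρ, |m x| ≤ C) (X X' : L2 ρ) :
    ‖mulOp hm hC (nemytskii hσ X - nemytskii hσ X')‖ ≤ L * ‖mulOp hm hC (X - X')‖ := by
  refine L2_norm_le_of_ae_le ?_
  filter_upwards [mulOp_apply hm hC (nemytskii hσ X - nemytskii hσ X'),
    mulOp_apply hm hC (X - X'), nemytskii_apply hσ X, nemytskii_apply hσ X',
    Lp.coeFn_sub X X', Lp.coeFn_sub (nemytskii hσ X) (nemytskii hσ X')] with x h1 h2 h3 h4 h5 h6
  rw [h1, h2, h5, h6, Pi.sub_apply, Pi.sub_apply, h3, h4, abs_mul, abs_mul, mul_left_comm]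
  exact mul_le_mul_of_nonneg_left (abs_sub_le_of_lipschitz hσ _ _) (abs_nonneg _)

theorem measurable_deriv_comp (X : L2 ρ) : Measurable fun x => deriv σ (X x) :=
  (measurable_deriv σ).comp (Lp.stronglyMeasurable X).measurable

theorem abs_deriv_le (hσ : LipschitzWith L σ) (x : ℝ) : |deriv σ x| ≤ L :=
  norm_deriv_le_of_lipschitz hσ

/-- Multiplication by `σ'(X)`. -/
def derivOp (hσ : LipschitzWith L σ) (X : L2 ρ) : L2 ρ →L[ℝ] L2 ρ :=
  mulOp (C := L) (measurable_deriv_comp (σ := σ) X)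
    (Filter.Eventually.of_forall fun x => abs_deriv_le hσ (X x))

theorem derivOp_apply (hσ : LipschitzWith L σ) (X ξ : L2 ρ) :
    derivOp hσ X ξ =ᵐ[ρ] fun x => deriv σ (X x) * ξ x := mulOp_apply _ _ ξ

/-- The superposition operator is Gateaux differentiable. -/
theorem tendsto_nemytskii_slope (hσ : LipschitzWith L σ) (hd : Differentiable ℝ σ) (X ξ : L2 ρ) :
    Filter.Tendsto (fun t : ℝ => t⁻¹ • (nemytskii hσ (X + t • ξ) - nemytskii hσ X))
      (nhdsWithin 0 {0}ᶜ) (nhds (derivOp hσ X ξ)) := by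
  set e : ℝ → L2 ρ := fun t =>
    t⁻¹ • (nemytskii hσ (X + t • ξ) - nemytskii hσ X) - derivOp hσ X ξ with he
  have hformula : ∀ t, e t =ᵐ[ρ] fun x =>
      t⁻¹ * (σ (X x + t * ξ x) - σ (X x)) - deriv σ (X x) * ξ x := by
    intro t
    filter_upwards [Lp.coeFn_sub (t⁻¹ • (nemytskii hσ (X + t • ξ) - nemytskii hσ X))
        (derivOp hσ X ξ), Lp.coeFn_smul t⁻¹ (nemytskii hσ (X + t • ξ) - nemytskii hσ X),
      Lp.coeFn_sub (nemytskii hσ (X + t • ξ)) (nemytskii hσ X), nemytskii_apply hσ X,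
      nemytskii_apply hσ (X + t • ξ), derivOp_apply hσ X ξ, Lp.coeFn_add X (t • ξ),
      Lp.coeFn_smul t ξ] with x h1 h2 h3 h4 h5 h6 h7 h8
    simp only [he]
    rw [h1, Pi.sub_apply, h2, Pi.smul_apply, h3, Pi.sub_apply, h4, h5, h6, h7, Pi.add_apply, h8,
      Pi.smul_apply, smul_eq_mul, smul_eq_mul]
  have hlim : ∀ x, Filter.Tendsto
      (fun t : ℝ => t⁻¹ * (σ (X x + t * ξ x) - σ (X x)) - deriv σ (X x) * ξ x)
      (nhdsWithin 0 {0}ᶜ) (nhds 0) := by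
    intro x
    have h1 : HasDerivAt (fun t : ℝ => X x + t * ξ x) (ξ x) 0 := by
      simpa using ((hasDerivAt_id (0 : ℝ)).mul_const (ξ x)).const_add (X x)
    have h2 : HasDerivAt (fun t : ℝ => σ (X x + t * ξ x)) (deriv σ (X x) * ξ x) 0 := by
      refine HasDerivAt.comp (h₂ := σ) (0 : ℝ) ?_ h1
      simpa using (hd (X x)).hasDerivAt
    have h3 := h2.tendsto_slope_zero
    simp only [zero_add, zero_mul, add_zero, smul_eq_mul] at h3
    simpa using h3.sub_const (deriv σ (X x) * ξ x)
  have hbound : ∀ t : ℝ, t ≠ 0 → ∀ x,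
      |t⁻¹ * (σ (X x + t * ξ x) - σ (X x)) - deriv σ (X x) * ξ x| ≤ 2 * L * |ξ x| := by
    intro t ht x
    have h1 : |t⁻¹ * (σ (X x + t * ξ x) - σ (X x))| ≤ L * |ξ x| := by
      rw [abs_mul, abs_inv]
      have := abs_sub_le_of_lipschitz hσ (X x + t * ξ x) (X x)
      rw [add_sub_cancel_left, abs_mul] at this
      have ht' : 0 < |t| := abs_pos.2 ht
      calc |t|⁻¹ * |σ (X x + t * ξ x) - σ (X x)| ≤ |t|⁻¹ * (L * (|t| * |ξ x|)) := by gcongr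
        _ = L * |ξ x| := by field_simp
    have h2 : |deriv σ (X x) * ξ x| ≤ L * |ξ x| := by
      rw [abs_mul]
      exact mul_le_mul_of_nonneg_right (abs_deriv_le hσ _) (abs_nonneg _)
    calc _ ≤ _ := abs_sub _ _
      _ ≤ L * |ξ x| + L * |ξ x| := add_le_add h1 h2
      _ = 2 * L * |ξ x| := by ring
  -- Dominated convergence: difference quotient and derivative are both bounded by L|ξ|, so (2L|ξ|)²
  -- dominates the squares.
  have hsq : Filter.Tendsto (fun t => ‖e t‖ ^ 2) (nhdsWithin 0 {0}ᶜ) (nhds 0) := by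
    have hint : Filter.Tendsto (fun t => ∫ x, (e t x) ^ 2 ∂ρ) (nhdsWithin 0 {0}ᶜ)
        (nhds (∫ _, (0 : ℝ) ∂ρ)) := by
      have hcongr : ∀ t, ∫ x, (e t x) ^ 2 ∂ρ =
          ∫ x, (t⁻¹ * (σ (X x + t * ξ x) - σ (X x)) - deriv σ (X x) * ξ x) ^ 2 ∂ρ := by
        intro t
        refine integral_congr_ae ?_
        filter_upwards [hformula t] with x hx
        rw [hx]
      simp only [hcongr]
      refine tendsto_integral_filter_of_dominated_convergence
        (fun x => (2 * L * |ξ x|) ^ 2) ?_ ?_ ?_ ?_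
      · refine Filter.Eventually.of_forall fun t => ?_
        exact ((Lp.aestronglyMeasurable (e t)).congr (hformula t)).pow 2
      · filter_upwards [self_mem_nhdsWithin] with t ht
        refine Filter.Eventually.of_forall fun x => ?_
        rw [Real.norm_eq_abs, abs_pow]
        exact pow_le_pow_left₀ (abs_nonneg _) (hbound t ht x) 2
      · have := ((Lp.memLp ξ).integrable_sq).const_mul ((2 * (L : ℝ)) ^ 2)
        refine this.congr (Filter.Eventually.of_forall fun x => ?_)
        simp only [mul_pow, sq_abs]
      · refine Filter.Eventually.of_forall fun x => ?_
        simpa using (hlim x).pow 2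
    simpa [L2_norm_sq_eq] using hint
  have hnorm : Filter.Tendsto (fun t => ‖e t‖) (nhdsWithin 0 {0}ᶜ) (nhds 0) := by
    simpa [Real.sqrt_sq] using hsq.sqrt
  exact tendsto_iff_norm_sub_tendsto_zero.2 hnorm

end Nemytskii

/-! ### The state equation for X: solvability and dependence on the parameters. -/

section Preactivation

variable {α : Type*} [MeasurableSpace α] {ρ : Measure α} [IsFiniteMeasure ρ] {T : ℝ}
  {σ : ℝ → ℝ} {L : ℝ≥0}

/-- The equation `X = a - C φ - V σ(X)` for the argument `X = a - ∫ b f` of the activation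
function along a forward solution `f` with initial value `φ`. -/
def IsPreactivation (hσ : LipschitzWith L σ) (a : L2 (ρ.prod (timeMeasure T)))
    (b : L2 (ρ.prod (ρ.prod (timeMeasure T)))) (φ : L2 ρ) (X : L2 (ρ.prod (timeMeasure T))) :
    Prop :=
  X = a - stateOp b φ - volterra b (TimeKernel.causal 0) (nemytskii hσ X)

/-- The form of smallness needed to absorb terms of size L‖V v‖; L + 1 replaces L so that one can
divide by it even when L = 0. -/
theorem exists_causal_damping (b : L2 (ρ.prod (ρ.prod (timeMeasure T)))) (L : ℝ≥0) :
    ∃ γ₀ : ℝ≥0, ∀ γ : ℝ≥0, γ₀ ≤ γ → ∀ v : L2 (ρ.prod (timeMeasure T)),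
      (L + 1) * ‖volterra b (TimeKernel.causal γ) v‖ ≤ 1 / 2 * ‖v‖ := by
  obtain ⟨γ₀, h⟩ := exists_damping b (ε := 1 / (2 * (L + 1))) (by positivity)
  refine ⟨γ₀, fun γ hγ v => ?_⟩
  have h1 := h γ hγ _ (TimeKernel.abs_causal_le γ) v
  calc (L + 1) * ‖volterra b (TimeKernel.causal γ) v‖
      ≤ (L + 1) * (1 / (2 * (L + 1)) * ‖v‖) := mul_le_mul_of_nonneg_left h1 (by positivity)
    _ = 1 / 2 * ‖v‖ := by field_simp

theorem expWeight_nemytskii_sub_le (hσ : LipschitzWith L σ) (γ : ℝ)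
    (X X' : L2 (ρ.prod (timeMeasure T))) :
    ‖expWeight ρ T γ (nemytskii hσ X - nemytskii hσ X')‖ ≤ L * ‖expWeight ρ T γ (X - X')‖ :=
  mulOp_nemytskii_sub_le hσ _ _ X X'

/-- Banach's fixed point theorem for the weighted unknown u = exp(-γs) X: for the chosen γ the
conjugated map is a contraction with constant 1/2. -/
theorem exists_isPreactivation (hσ : LipschitzWith L σ) (a : L2 (ρ.prod (timeMeasure T)))
    (b : L2 (ρ.prod (ρ.prod (timeMeasure T)))) (φ : L2 ρ) :
    ∃ X, IsPreactivation hσ a b φ X := by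
  obtain ⟨γ, hγ⟩ := exists_causal_damping b L
  have hγ := hγ γ le_rfl
  set M := expWeight ρ T (-γ) with hM
  set M' := expWeight ρ T γ with hM'
  have hMM' : ∀ v, M (M' v) = v := expWeight_neg_apply (γ : ℝ)
  have hM'M : ∀ v, M' (M v) = v := expWeight_apply_neg (γ : ℝ)
  let Φ : L2 (ρ.prod (timeMeasure T)) → L2 (ρ.prod (timeMeasure T)) := fun u =>
    M (a - stateOp b φ - volterra b (TimeKernel.causal 0) (nemytskii hσ (M' u)))
  have hΦ : ContractingWith (1 / 2) Φ := by
    refine ⟨by rw [← NNReal.coe_lt_coe]; norm_num, LipschitzWith.of_dist_le_mul fun u u' => ?_⟩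
    rw [dist_eq_norm, dist_eq_norm]
    have e : Φ u - Φ u' = - volterra b (TimeKernel.causal γ)
        (M (nemytskii hσ (M' u) - nemytskii hσ (M' u'))) := by
      rw [hM, ← expWeight_causal]
      simp only [Φ, map_sub]
      abel
    have h2 := expWeight_nemytskii_sub_le hσ (-(γ : ℝ)) (M' u) (M' u')
    rw [← hM, map_sub M (M' u), hMM', hMM'] at h2
    have h3 := hγ (M (nemytskii hσ (M' u) - nemytskii hσ (M' u')))
    rw [e, norm_neg]
    have h4 : (L + 1) * ‖volterra b (TimeKernel.causal γ)
        (M (nemytskii hσ (M' u) - nemytskii hσ (M' u')))‖ ≤ (L + 1) * (1 / 2 * ‖u - u'‖) := by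
      nlinarith [norm_nonneg (u - u')]
    simpa using le_of_mul_le_mul_left h4 (by positivity)
  have hfix := hΦ.fixedPoint_isFixedPt
  refine ⟨M' (ContractingWith.fixedPoint Φ hΦ), ?_⟩
  unfold IsPreactivation
  conv_lhs => rw [← hfix.eq]
  exact hM'M _

/-- The linearized state operator is invertible. -/
theorem isUnit_one_add_volterra (hσ : LipschitzWith L σ)
    (b : L2 (ρ.prod (ρ.prod (timeMeasure T)))) (X : L2 (ρ.prod (timeMeasure T))) :
    IsUnit (1 + (volterra b (TimeKernel.causal 0)).comp (derivOp hσ X)) := by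
  obtain ⟨γ, hγ⟩ := exists_causal_damping b L
  have hγ := hγ γ le_rfl
  set M := expWeight ρ T (-γ) with hM
  -- The damped version is inverted by a Neumann series. Multiplication by σ'(X) commutes with the
  -- weight, so the undamped operator is conjugate to it.
  have hu : IsUnit (1 - (-((volterra b (TimeKernel.causal γ)).comp (derivOp hσ X)))) := by
    refine isUnit_one_sub_of_norm_lt_one ?_
    rw [norm_neg]
    refine lt_of_le_of_lt (ContinuousLinearMap.opNorm_le_bound _ (M := 1 / 2) (by norm_num)
      fun v => ?_) (by norm_num)
    have h1 := hγ (derivOp hσ X v)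
    have h2 : ‖derivOp hσ X v‖ ≤ L * ‖v‖ := mulOp_norm_le _ _ v
    have h3 : (L + 1) * ‖volterra b (TimeKernel.causal γ) (derivOp hσ X v)‖ ≤
        (L + 1) * (1 / 2 * ‖v‖) := by
      nlinarith [norm_nonneg v]
    exact le_of_mul_le_mul_left h3 (by positivity)
  obtain ⟨m, hm⟩ := isUnit_expWeight (ρ := ρ) (T := T) (-(γ : ℝ))
  have hconj : M * (1 + (volterra b (TimeKernel.causal 0)).comp (derivOp hσ X)) =
      (1 - (-((volterra b (TimeKernel.causal γ)).comp (derivOp hσ X)))) * M := by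
    ext1 v
    simp only [mul_apply_eq_comp, add_apply, sub_neg_eq_add,
      one_apply_eq_self, ContinuousLinearMap.comp_apply, map_add, hM,
      expWeight_causal]
    congr 2
    exact mulOp_comm _ _ _ _ v
  rw [← Units.isUnit_units_mul m, hm, ← hM, hconj]
  exact hu.mul (hM ▸ isUnit_expWeight _)

theorem IsPreactivation.sub_eq (hσ : LipschitzWith L σ)
    {a α' : L2 (ρ.prod (timeMeasure T))} {b β : L2 (ρ.prod (ρ.prod (timeMeasure T)))} {φ : L2 ρ}
    {X X' : L2 (ρ.prod (timeMeasure T))} {t : ℝ} (hX : IsPreactivation hσ a b φ X)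
    (hX' : IsPreactivation hσ (a + t • α') (b + t • β) φ X') :
    X' - X = t • (α' - stateOp β φ - volterra β (TimeKernel.causal 0) (nemytskii hσ X)) -
      t • volterra β (TimeKernel.causal 0) (nemytskii hσ X' - nemytskii hσ X) -
      volterra b (TimeKernel.causal 0) (nemytskii hσ X' - nemytskii hσ X) := by
  unfold IsPreactivation at hX hX'
  conv_lhs => rw [hX, hX']
  rw [stateOp_add_smul, volterra_add_smul, map_sub, map_sub]
  module

/-- The velocity depends in a Lipschitz continuous way on the parameters along a line. -/
theorem eventually_norm_nemytskii_sub_le (hσ : LipschitzWith L σ)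
    {a α' : L2 (ρ.prod (timeMeasure T))} {b β : L2 (ρ.prod (ρ.prod (timeMeasure T)))} {φ : L2 ρ}
    {X₀ : L2 (ρ.prod (timeMeasure T))} {X : ℝ → L2 (ρ.prod (timeMeasure T))}
    (hX₀ : IsPreactivation hσ a b φ X₀)
    (hX : ∀ t, IsPreactivation hσ (a + t • α') (b + t • β) φ (X t)) :
    ∃ C, ∀ᶠ t in nhds (0 : ℝ), ‖nemytskii hσ (X t) - nemytskii hσ X₀‖ ≤ C * |t| := by
  obtain ⟨γ₁, hγ₁⟩ := exists_causal_damping b L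
  obtain ⟨γ₂, hγ₂⟩ := exists_causal_damping β L
  set γ := max γ₁ γ₂
  have hγ₁ := hγ₁ γ (le_max_left _ _)
  have hγ₂ := hγ₂ γ (le_max_right _ _)
  set M := expWeight ρ T (-γ) with hM
  set M' := expWeight ρ T γ with hM'
  have hM'M : ∀ v, M' (M v) = v := expWeight_apply_neg (γ : ℝ)
  set η := α' - stateOp β φ - volterra β (TimeKernel.causal 0) (nemytskii hσ X₀) with hη
  -- For |t| < 1/2 the damped terms contribute at most (1/4 + 1/2)‖M δ‖. Absorbing them leaves 1/4
  -- on the left, hence the factor 4.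
  refine ⟨‖M'‖ * (4 * (L * ‖M η‖)), ?_⟩
  have hsmall : ∀ᶠ t in nhds (0 : ℝ), |t| < 1 / 2 := by
    have : Filter.Tendsto (fun t : ℝ => |t|) (nhds 0) (nhds |0|) := continuous_abs.tendsto 0
    rw [abs_zero] at this
    exact this.eventually_lt_const (by norm_num)
  filter_upwards [hsmall] with t ht
  set δ := nemytskii hσ (X t) - nemytskii hσ X₀ with hδ
  have h1 : ‖M δ‖ ≤ L * ‖M (X t - X₀)‖ := expWeight_nemytskii_sub_le hσ (-(γ : ℝ)) (X t) X₀
  rw [hX₀.sub_eq hσ (hX t), ← hη, ← hδ] at h1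
  clear_value δ
  rw [map_sub, map_sub, map_smul, map_smul, hM,
    expWeight_causal, expWeight_causal, ← hM] at h1
  have h2 : ‖t • M η - t • volterra β (TimeKernel.causal γ) (M δ) -
      volterra b (TimeKernel.causal γ) (M δ)‖ ≤ |t| * ‖M η‖ +
      |t| * ‖volterra β (TimeKernel.causal γ) (M δ)‖ + ‖volterra b (TimeKernel.causal γ) (M δ)‖ := by
    refine (norm_sub_le _ _).trans (add_le_add_left ((norm_sub_le _ _).trans_eq ?_) _)
    rw [norm_smul, norm_smul, Real.norm_eq_abs]
  have h3 := hγ₁ (M δ)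
  have h4 := hγ₂ (M δ)
  have hL : (0 : ℝ) ≤ L := L.2
  have h5 : ‖M δ‖ ≤ 4 * (L * ‖M η‖) * |t| := by
    have h6 := h1.trans (mul_le_mul_of_nonneg_left h2 hL)
    set P := ‖volterra β (TimeKernel.causal γ) (M δ)‖
    set Q := ‖volterra b (TimeKernel.causal γ) (M δ)‖
    have hP : 0 ≤ P := norm_nonneg _
    have hQ : 0 ≤ Q := norm_nonneg _
    have h7 : |t| * (L * P) ≤ 1 / 2 * (1 / 2 * ‖M δ‖) := by
      refine mul_le_mul ht.le ?_ (by positivity) (by norm_num)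
      linarith
    linarith
  calc ‖δ‖ = ‖M' (M δ)‖ := by rw [hM'M]
    _ ≤ ‖M'‖ * ‖M δ‖ := M'.le_opNorm _
    _ ≤ ‖M'‖ * (4 * (L * ‖M η‖) * |t|) := mul_le_mul_of_nonneg_left h5 (norm_nonneg _)
    _ = _ := by ring

/-- The derivative of the velocity along a line in the parameter space solves the linearized
state equation. -/
theorem hasDerivAt_nemytskii (hσ : LipschitzWith L σ) (hd : Differentiable ℝ σ)
    {a α' : L2 (ρ.prod (timeMeasure T))} {b β : L2 (ρ.prod (ρ.prod (timeMeasure T)))} {φ : L2 ρ}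
    {X₀ : L2 (ρ.prod (timeMeasure T))} {X : ℝ → L2 (ρ.prod (timeMeasure T))}
    (hX₀ : IsPreactivation hσ a b φ X₀)
    (hX : ∀ t, IsPreactivation hσ (a + t • α') (b + t • β) φ (X t))
    {ξ : L2 (ρ.prod (timeMeasure T))}
    (hξ : ξ + volterra b (TimeKernel.causal 0) (derivOp hσ X₀ ξ) =
      α' - stateOp β φ - volterra β (TimeKernel.causal 0) (nemytskii hσ X₀)) :
    Filter.Tendsto (fun t : ℝ => t⁻¹ • (nemytskii hσ (X t) - nemytskii hσ X₀))
      (nhdsWithin 0 {0}ᶜ) (nhds (derivOp hσ X₀ ξ)) := by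
  obtain ⟨γ, hγ⟩ := exists_causal_damping b L
  have hγ := hγ γ le_rfl
  set M := expWeight ρ T (-γ) with hM
  set M' := expWeight ρ T γ with hM'
  have hM'M : ∀ v, M' (M v) = v := expWeight_apply_neg (γ : ℝ)
  set δ : ℝ → L2 (ρ.prod (timeMeasure T)) := fun t => nemytskii hσ (X t) - nemytskii hσ X₀ with hδ
  set e : ℝ → L2 (ρ.prod (timeMeasure T)) := fun t =>
    t⁻¹ • (nemytskii hσ (X₀ + t • ξ) - nemytskii hσ X₀) - derivOp hσ X₀ ξ with he
  obtain ⟨C, hC⟩ := eventually_norm_nemytskii_sub_le hσ hX₀ hX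
  have hδ0 : Filter.Tendsto δ (nhdsWithin 0 {0}ᶜ) (nhds 0) := by
    refine Filter.Tendsto.mono_left ?_ nhdsWithin_le_nhds
    refine squeeze_zero_norm' hC ?_
    have : Continuous fun t : ℝ => C * |t| := by fun_prop
    simpa using this.tendsto 0
  have he0 : Filter.Tendsto e (nhdsWithin 0 {0}ᶜ) (nhds 0) :=
    tendsto_sub_nhds_zero_iff.2 (tendsto_nemytskii_slope hσ hd X₀ ξ)
  have hkey : ∀ t : ℝ, t ≠ 0 → ‖M (t⁻¹ • δ t - derivOp hσ X₀ ξ)‖ ≤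
      2 * (‖M (e t)‖ + L * ‖M (volterra β (TimeKernel.causal 0) (δ t))‖) := by
    intro t ht
    set q := t⁻¹ • δ t - derivOp hσ X₀ ξ with hq
    -- Comparison with the straight line X₀ + tξ: Gateaux differentiability is needed only in the
    -- fixed direction ξ, and X t - (X₀ + tξ) is handled by the Lipschitz bound. Its part containing
    -- q is absorbed by damping.
    have h1 : q = t⁻¹ • (nemytskii hσ (X t) - nemytskii hσ (X₀ + t • ξ)) + e t := by
      simp only [hq, hδ, he]
      module
    have h2 : t⁻¹ • (X t - (X₀ + t • ξ)) =
        -volterra β (TimeKernel.causal 0) (δ t) - volterra b (TimeKernel.causal 0) q := by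
      have h3 : X t - (X₀ + t • ξ) = t • (-volterra β (TimeKernel.causal 0) (δ t) -
          volterra b (TimeKernel.causal 0) q) := by
        rw [← sub_sub, hX₀.sub_eq hσ (hX t), ← hξ]
        simp only [hq, map_sub, map_smul, smul_sub, smul_add, smul_neg, smul_smul,
          mul_inv_cancel₀ ht, one_smul, hδ]
        abel
      rw [h3, smul_smul, inv_mul_cancel₀ ht, one_smul]
    have h4 : ‖M (t⁻¹ • (nemytskii hσ (X t) - nemytskii hσ (X₀ + t • ξ)))‖ ≤
        L * ‖M (t⁻¹ • (X t - (X₀ + t • ξ)))‖ := by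
      rw [map_smul, map_smul, norm_smul, norm_smul, mul_left_comm]
      exact mul_le_mul_of_nonneg_left (expWeight_nemytskii_sub_le hσ _ _ _) (norm_nonneg _)
    have h5 : ‖M (t⁻¹ • (X t - (X₀ + t • ξ)))‖ ≤ ‖M (volterra β (TimeKernel.causal 0) (δ t))‖ +
        ‖volterra b (TimeKernel.causal γ) (M q)‖ := by
      rw [h2, map_sub, map_neg, ← expWeight_causal]
      refine (norm_sub_le _ _).trans_eq ?_
      rw [norm_neg]
    have h6 : ‖M q‖ ≤ ‖M (t⁻¹ • (nemytskii hσ (X t) - nemytskii hσ (X₀ + t • ξ)))‖ + ‖M (e t)‖ := by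
      conv_lhs => rw [h1, map_add]
      exact norm_add_le _ _
    have h7 := hγ (M q)
    have h8 := h4.trans (mul_le_mul_of_nonneg_left h5 L.2)
    have h9 := norm_nonneg (volterra b (TimeKernel.causal γ) (M q))
    linarith
  have hlim : Filter.Tendsto (fun t => 2 * (‖M (e t)‖ +
      L * ‖M (volterra β (TimeKernel.causal 0) (δ t))‖)) (nhdsWithin 0 {0}ᶜ) (nhds 0) := by
    have h1 := ((M.continuous.tendsto _).comp he0).norm
    have h2 := (((M.comp (volterra β (TimeKernel.causal 0))).continuous.tendsto _).comp hδ0).norm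
    simpa using (h1.add (h2.const_mul (L : ℝ))).const_mul 2
  have hMq : Filter.Tendsto (fun t => M (t⁻¹ • δ t - derivOp hσ X₀ ξ))
      (nhdsWithin 0 {0}ᶜ) (nhds 0) := by
    refine squeeze_zero_norm' ?_ hlim
    filter_upwards [self_mem_nhdsWithin] with t ht
    exact hkey t ht
  have h := (M'.continuous.tendsto _).comp hMq
  rw [map_zero] at h
  refine tendsto_sub_nhds_zero_iff.1 (h.congr fun t => ?_)
  exact hM'M _

end Preactivation

/-! ### Unique continuation for the adjoint equation. -/

section Adjoint

variable {α : Type*} [MeasurableSpace α] {ρ : Measure α} [IsFiniteMeasure ρ] {T : ℝ}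
  {σ : ℝ → ℝ} {L : ℝ≥0}

theorem measurable_timeCutoff (t₀ : ℝ) :
    Measurable fun p : α × ℝ => if p.2 < t₀ then (1 : ℝ) else 0 :=
  Measurable.ite (measurableSet_lt measurable_snd measurable_const) measurable_const
    measurable_const

/-- Multiplication by `𝟙(s < t₀)`. -/
def timeCutoff (ρ : Measure α) [IsFiniteMeasure ρ] (T t₀ : ℝ) :
    L2 (ρ.prod (timeMeasure T)) →L[ℝ] L2 (ρ.prod (timeMeasure T)) :=
  mulOp (C := 1) (measurable_timeCutoff t₀)
    (Filter.Eventually.of_forall fun p => by split_ifs <;> simp)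

theorem timeCutoff_apply (t₀ : ℝ) (v : L2 (ρ.prod (timeMeasure T))) :
    timeCutoff ρ T t₀ v =ᵐ[ρ.prod (timeMeasure T)]
      fun p => (if p.2 < t₀ then 1 else 0) * v p := mulOp_apply _ _ v

theorem timeCutoff_eq_zero_iff (t₀ : ℝ) (v : L2 (ρ.prod (timeMeasure T))) :
    timeCutoff ρ T t₀ v = 0 ↔ ∀ᵐ p ∂(ρ.prod (timeMeasure T)), p.2 < t₀ → v p = 0 := by
  rw [Lp.eq_zero_iff_ae_eq_zero]
  constructor
  · intro h
    filter_upwards [h, timeCutoff_apply t₀ v] with p h1 h2 h3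
    rw [h2, if_pos h3, one_mul] at h1
    exact h1
  · intro h
    filter_upwards [h, timeCutoff_apply t₀ v] with p h1 h2
    rw [h2]
    split_ifs with h3
    · rw [h1 h3, mul_zero, Pi.zero_apply]
    · rw [zero_mul, Pi.zero_apply]

/-- At time s the anticausal integral sees only r ≥ s, so an input supported before t₀ has output
supported before t₀. -/
theorem timeCutoff_anticausal (t₀ : ℝ) (b : L2 (ρ.prod (ρ.prod (timeMeasure T))))
    (u : L2 (ρ.prod (timeMeasure T))) :
    timeCutoff ρ T t₀ (volterra b (TimeKernel.anticausal 0) (timeCutoff ρ T t₀ u)) =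
      volterra b (TimeKernel.anticausal 0) (timeCutoff ρ T t₀ u) := by
  refine Lp.ext ?_
  filter_upwards [timeCutoff_apply t₀ (volterra b (TimeKernel.anticausal 0) (timeCutoff ρ T t₀ u)),
    volterra_apply b (TimeKernel.anticausal 0) (timeCutoff ρ T t₀ u)] with p h1 h2
  rw [h1]
  split_ifs with h
  · rw [one_mul]
  · rw [zero_mul, h2]
    symm
    refine integral_eq_zero_of_ae ?_
    filter_upwards [Measure.ae_ae_of_ae_prod (timeCutoff_apply t₀ u)] with z hz
    rw [Pi.zero_apply]
    refine mul_eq_zero_of_right _ (integral_eq_zero_of_ae ?_)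
    filter_upwards [hz] with r hr
    rw [hr, Pi.zero_apply]
    simp only [TimeKernel.anticausal]
    split_ifs with h3 h4
    · simp
    · simp
    · linarith
    · simp

/-- Dual to `timeCutoff_anticausal`: the adjoint of an anticausal operator is causal, so vanishing
before t₀ is inherited. -/
theorem timeCutoff_adjoint_anticausal {t₀ : ℝ} (b : L2 (ρ.prod (ρ.prod (timeMeasure T))))
    {p : L2 (ρ.prod (timeMeasure T))} (hp : timeCutoff ρ T t₀ p = 0) :
    timeCutoff ρ T t₀
      (ContinuousLinearMap.adjoint (volterra b (TimeKernel.anticausal 0)) p) = 0 := by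
  refine ext_inner_right ℝ fun u => ?_
  have h1 := mulOp_inner (measurable_timeCutoff t₀) (C := 1) (ρ := ρ.prod (timeMeasure T))
    (Filter.Eventually.of_forall fun p => by split_ifs <;> simp)
  change ∀ f g, inner ℝ (timeCutoff ρ T t₀ f) g = inner ℝ f (timeCutoff ρ T t₀ g) at h1
  rw [h1, ContinuousLinearMap.adjoint_inner_left, ← timeCutoff_anticausal, ← h1, hp]
  simp

theorem eq_zero_of_timeCutoff_timeConst {t₀ : ℝ} (hT : 0 < T) (ht₀ : 0 < t₀) {c : L2 ρ}
    (h : timeCutoff ρ T t₀ (timeConst T c) = 0) : c = 0 := by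
  rw [timeCutoff_eq_zero_iff] at h
  rw [Lp.eq_zero_iff_ae_eq_zero]
  filter_upwards [Measure.ae_ae_of_ae_prod h,
    Measure.ae_ae_of_ae_prod (timeConst_apply (T := T) c)] with y h1 h2
  by_contra hne
  have h3 : ∀ᵐ r ∂(timeMeasure T), ¬ r < t₀ := by
    filter_upwards [h1, h2] with r h4 h5 h6
    exact hne ((h5.symm).trans (h4 h6))
  rw [ae_iff] at h3
  simp only [not_not] at h3
  have h7 : timeMeasure T (Ioo 0 (min t₀ T)) = 0 :=
    measure_mono_null (fun r hr => lt_of_lt_of_le hr.2 (min_le_left _ _)) h3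
  rw [Measure.restrict_apply measurableSet_Ioo, inter_eq_left.2
    (Ioo_subset_Ioo_right (min_le_right _ _)), Real.volume_Ioo, ENNReal.ofReal_eq_zero] at h7
  have : 0 < min t₀ T := lt_min ht₀ hT
  linarith

theorem eq_zero_of_timeConst (hT : 0 < T) {c : L2 ρ} (h : timeConst T c = 0) : c = 0 :=
  eq_zero_of_timeCutoff_timeConst hT hT (by rw [h, map_zero])

theorem adjoint_expWeight (γ : ℝ) :
    ContinuousLinearMap.adjoint (expWeight ρ T γ) = expWeight ρ T γ := adjoint_mulOp _ _

theorem expWeight_adjoint_anticausal (b : L2 (ρ.prod (ρ.prod (timeMeasure T)))) (γ : ℝ≥0)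
    (p : L2 (ρ.prod (timeMeasure T))) :
    expWeight ρ T (-γ) (ContinuousLinearMap.adjoint (volterra b (TimeKernel.anticausal 0)) p) =
      ContinuousLinearMap.adjoint (volterra b (TimeKernel.anticausal γ))
        (expWeight ρ T (-γ) p) := by
  have h1 : ∀ f, ContinuousLinearMap.adjoint (volterra b (TimeKernel.anticausal 0))
      (expWeight ρ T γ f) = expWeight ρ T γ
        (ContinuousLinearMap.adjoint (volterra b (TimeKernel.anticausal γ)) f) := by
    intro f
    refine ext_inner_right ℝ fun u => ?_
    rw [← adjoint_expWeight, ContinuousLinearMap.adjoint_inner_left,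
      ContinuousLinearMap.adjoint_inner_left, ContinuousLinearMap.adjoint_inner_left,
      ContinuousLinearMap.adjoint_inner_left, expWeight_anticausal]
  conv_lhs => rw [← expWeight_apply_neg (γ : ℝ) p, h1, expWeight_neg_apply]

/-- A homogeneous linear Volterra equation running forward in time: in the norm weighted by exp(-γs)
the right-hand side has norm at most half that of q. -/
theorem eq_zero_of_eq_adjoint_anticausal (hσ : LipschitzWith L σ)
    (b : L2 (ρ.prod (ρ.prod (timeMeasure T)))) (X : L2 (ρ.prod (timeMeasure T)))
    {q : L2 (ρ.prod (timeMeasure T))}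
    (hq : q = ContinuousLinearMap.adjoint (volterra b (TimeKernel.anticausal 0))
      (derivOp hσ X q)) : q = 0 := by
  obtain ⟨γ, hγ⟩ := exists_damping b (ε := 1 / (2 * (L + 1))) (by positivity)
  have hγ := hγ γ le_rfl _ (TimeKernel.abs_anticausal_le γ)
  set q' := expWeight ρ T (-γ) q with hq'
  have h1 : q' = ContinuousLinearMap.adjoint (volterra b (TimeKernel.anticausal γ))
      (derivOp hσ X q') := by
    conv_lhs => rw [hq', hq, expWeight_adjoint_anticausal]
    congr 1
    exact mulOp_comm _ _ _ _ q
  have h2 : ‖ContinuousLinearMap.adjoint (volterra b (TimeKernel.anticausal γ))‖ ≤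
      1 / (2 * (L + 1)) := by
    rw [LinearIsometryEquiv.norm_map]
    exact ContinuousLinearMap.opNorm_le_bound _ (by positivity) hγ
  have h3 : ‖q'‖ ≤ 1 / (2 * (L + 1)) * (L * ‖q'‖) := by
    conv_lhs => rw [h1]
    refine (ContinuousLinearMap.le_opNorm _ _).trans ?_
    exact mul_le_mul h2 (mulOp_norm_le _ _ _) (norm_nonneg _) (by positivity)
  have h4 : 1 / (2 * (L + 1)) * (L * ‖q'‖) = (L / (L + 1)) * (1 / 2 * ‖q'‖) := by field_simp
  have h5 : (L / (L + 1) : ℝ) ≤ 1 := by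
    rw [div_le_one (by positivity)]
    linarith
  have h6 : q' = 0 := by
    rw [← norm_le_zero_iff]
    nlinarith [norm_nonneg q']
  rw [← expWeight_apply_neg (γ : ℝ) q, ← hq', h6, map_zero]

/-- Unique continuation for the adjoint equation: a solution that vanishes near the initial time
has vanishing terminal value. -/
theorem eq_zero_of_adjoint_eq_zero_near_zero (hT : 0 < T) (hσ : LipschitzWith L σ)
    (hpos : ∀ x, 0 < deriv σ x) (b : L2 (ρ.prod (ρ.prod (timeMeasure T))))
    (X : L2 (ρ.prod (timeMeasure T))) {g : L2 ρ} {p : L2 (ρ.prod (timeMeasure T))}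
    (hp : p = derivOp hσ X (ContinuousLinearMap.adjoint (timeIntegral ρ T) g -
      ContinuousLinearMap.adjoint (volterra b (TimeKernel.causal 0)) p))
    {t₀ : ℝ} (ht₀ : 0 < t₀) (hzero : ∀ᵐ x ∂(ρ.prod (timeMeasure T)), x.2 < t₀ → p x = 0) :
    g = 0 := by
  set q := ContinuousLinearMap.adjoint (timeIntegral ρ T) g -
      ContinuousLinearMap.adjoint (volterra b (TimeKernel.causal 0)) p with hq
  -- Here σ' > 0 enters: p = σ'(X) q, so q vanishes wherever p does.
  have hQq : timeCutoff ρ T t₀ q = 0 := by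
    rw [timeCutoff_eq_zero_iff]
    filter_upwards [hzero, derivOp_apply hσ X q] with x h1 h2 h3
    rw [← hp, h1 h3] at h2
    exact (mul_eq_zero.1 h2.symm).resolve_left (hpos _).ne'
  have hQp : timeCutoff ρ T t₀ p = 0 := (timeCutoff_eq_zero_iff t₀ p).2 hzero
  -- The adjoint of the causal operator runs backward from T. Replacing it by the full integral
  -- minus the anticausal part turns the equation into a forward one whose initial value is the
  -- time-constant term c.
  have hsum : volterra b (TimeKernel.causal 0) + volterra b (TimeKernel.anticausal 0) =
      (stateOp b).comp (timeIntegral ρ T) := by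
    ext1 v
    rw [add_apply, ContinuousLinearMap.comp_apply, ← volterra_one_apply hT]
    refine volterra_add_kernel b _ _ _ (fun s r => ?_) v
    simp only [TimeKernel.causal, TimeKernel.anticausal, TimeKernel.one]
    split_ifs <;> simp
  set c := g - ContinuousLinearMap.adjoint (stateOp b) p with hc
  have hqc : q = timeConst T c +
      ContinuousLinearMap.adjoint (volterra b (TimeKernel.anticausal 0)) p := by
    have h1 : ContinuousLinearMap.adjoint (volterra b (TimeKernel.causal 0)) p +
        ContinuousLinearMap.adjoint (volterra b (TimeKernel.anticausal 0)) p =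
        timeConst T (ContinuousLinearMap.adjoint (stateOp b) p) := by
      rw [← adjoint_timeIntegral, ← add_apply, ← map_add, hsum, ContinuousLinearMap.adjoint_comp,
        ContinuousLinearMap.comp_apply]
    rw [hq, hc, ← adjoint_timeIntegral, map_sub,
      adjoint_timeIntegral (ContinuousLinearMap.adjoint (stateOp b) p), ← h1]
    abel
  -- Before t₀ both q and the causal term vanish; being constant in time, c then vanishes
  -- altogether.
  have hc0 : c = 0 := by
    refine eq_zero_of_timeCutoff_timeConst hT ht₀ ?_
    have h1 := congrArg (timeCutoff ρ T t₀) hqc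
    rw [map_add, timeCutoff_adjoint_anticausal b hQp, hQq, add_zero] at h1
    exact h1.symm
  have hq0 : q = 0 := by
    refine eq_zero_of_eq_adjoint_anticausal hσ b X ?_
    rw [← hp]
    conv_lhs => rw [hqc, hc0, ← adjoint_timeIntegral, map_zero, zero_add]
  have hp0 : p = 0 := by rw [hp, hq0, map_zero]
  rw [hp0, map_zero, sub_zero, adjoint_timeIntegral, hq0] at hq
  exact eq_zero_of_timeConst hT hq.symm

end Adjoint

/-! ### Time trajectories and measurability of the pairing with b. -/

section Trajectory

variable {α : Type*} [MeasurableSpace α] {ρ : Measure α} [IsFiniteMeasure ρ] {T : ℝ}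

theorem intervalIntegral_eq_causal {t : ℝ} (ht : t ∈ Icc 0 T) (g : ℝ → ℝ) :
    ∫ s in (0 : ℝ)..t, g s = ∫ r, (TimeKernel.causal 0).toFun t r * g r ∂(timeMeasure T) := by
  have e : (fun r => (TimeKernel.causal 0).toFun t r * g r) = (Iio t).indicator g := by
    ext r
    by_cases h : r < t
    · simp [TimeKernel.causal, h]
    · simp [TimeKernel.causal, h]
  have e2 : Iio t ∩ Ioo 0 T = Ioo 0 t := by
    ext r
    constructor
    · rintro ⟨h1, h2, h3⟩
      exact ⟨h2, h1⟩
    · rintro ⟨h1, h2⟩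
      exact ⟨h2, h1, h2.trans_le ht.2⟩
  rw [e, integral_indicator measurableSet_Iio, Measure.restrict_restrict measurableSet_Iio, e2,
    intervalIntegral.integral_of_le ht.1, integral_Ioc_eq_integral_Ioo]

theorem kernelOp_timeInd_eq_causal (v : L2 (ρ.prod (timeMeasure T))) (t : ℝ) :
    kernelOp v (timeInd T t) =ᵐ[ρ]
      fun y => ∫ r, (TimeKernel.causal 0).toFun t r * v (y, r) ∂(timeMeasure T) := by
  filter_upwards [kernelOp_timeInd v t] with y h
  rw [h]
  simp [TimeKernel.causal]

theorem continuous_timeInd (T : ℝ) : Continuous (timeInd T) := by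
  refine continuous_indicatorConstLp_set (by norm_num) fun t => ?_
  have hle : ∀ x, timeMeasure T (symmDiff (Iio x) (Iio t)) ≤ ENNReal.ofReal |x - t| := by
    intro x
    refine (Measure.restrict_le_self _).trans ?_
    rw [abs_sub_comm, ← Real.volume_interval]
    refine measure_mono fun r hr => ?_
    rw [mem_symmDiff, mem_Iio, mem_Iio, not_lt, not_lt] at hr
    rw [mem_uIcc]
    rcases hr with h | h
    · exact Or.inr ⟨h.2, h.1.le⟩
    · exact Or.inl ⟨h.2, h.1.le⟩
  refine tendsto_of_tendsto_of_tendsto_of_le_of_le tendsto_const_nhds ?_ (fun _ => zero_le) hle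
  have : Continuous fun x : ℝ => ENNReal.ofReal |x - t| :=
    ENNReal.continuous_ofReal.comp (by fun_prop)
  simpa using this.tendsto t

/-- The bridge between the equation for X and the forward problem: Cφ + Vv at time s is b applied to
the trajectory value φ + ∫₀ˢ v. -/
theorem stateOp_add_volterra_apply (hT : 0 < T) (b : L2 (ρ.prod (ρ.prod (timeMeasure T))))
    (φ : L2 ρ) (v : L2 (ρ.prod (timeMeasure T))) :
    ∀ᵐ p ∂(ρ.prod (timeMeasure T)),
      stateOp b φ p + volterra b (TimeKernel.causal 0) v p =
        ∫ z, b (p.1, z, p.2) * (φ + kernelOp v (timeInd T p.2)) z ∂ρ := by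
  filter_upwards [stateOp_apply hT b φ, volterra_apply b (TimeKernel.causal 0) v,
    state_slice_integrable b φ, volterra_slice_integrable b (TimeKernel.causal 0) v]
    with p h1 h2 h3 h4
  rw [h1, h2, ← integral_add h3 h4]
  refine integral_congr_ae ?_
  filter_upwards [kernelOp_timeInd_eq_causal v p.2,
    Lp.coeFn_add φ (kernelOp v (timeInd T p.2))] with z h5 h6
  rw [h6, Pi.add_apply, h5, mul_add]

/-- The representatives of f s are chosen separately for each s and need not be jointly measurable.
Instead, the pairing with time s in f decoupled from p is a Carathéodory function: continuous in s,
as an L² inner product, and measurable in p. Hence it is jointly measurable and may be evaluated at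
s = p.2. -/
theorem aestronglyMeasurable_pairing {f : ℝ → L2 ρ} (hf : ContinuousOn f (Icc 0 T)) (hT : 0 < T)
    (b : L2 (ρ.prod (ρ.prod (timeMeasure T)))) :
    AEStronglyMeasurable (fun p : α × ℝ => ∫ z, b (p.1, z, p.2) * f p.2 z ∂ρ)
      (ρ.prod (timeMeasure T)) := by
  set g : ℝ → L2 ρ := IccExtend hT.le ((Icc 0 T).domRestrict f) with hg
  have hgc : Continuous g := (continuousOn_iff_continuous_domRestrict.1 hf).Icc_extend'
  have hgf : ∀ s ∈ Icc 0 T, g s = f s := fun s hs => IccExtend_of_mem hT.le _ hs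
  have hbm : Measurable fun q : (α × ℝ) × α => b (q.1.1, q.2, q.1.2) :=
    (Lp.stronglyMeasurable b).measurable.comp (by fun_prop)
  -- The measurable set of full measure on which the slice of b lies in L²; off it the pairing is
  -- set to zero so that continuity in s holds for every p.
  set G : Set (α × ℝ) := {p | ∫⁻ z, ‖b (p.1, z, p.2)‖ₑ ^ (2 : ℝ) ∂ρ < ∞} with hG
  have hGm : MeasurableSet G := by
    refine measurableSet_lt (Measurable.lintegral_prod_right' (ν := ρ)
      (f := fun q : (α × ℝ) × α => ‖b (q.1.1, q.2, q.1.2)‖ₑ ^ (2 : ℝ)) ?_) measurable_const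
    exact hbm.enorm.pow_const _
  have hGL : ∀ p ∈ G, MemLp (fun z => b (p.1, z, p.2)) 2 ρ := by
    intro p hp
    refine ⟨(hbm.comp measurable_prodMk_left).aestronglyMeasurable, ?_⟩
    rw [eLpNorm_two_eq]
    exact ENNReal.rpow_lt_top_of_nonneg (by norm_num) hp.ne
  have hGae : ∀ᵐ p ∂(ρ.prod (timeMeasure T)), p ∈ G := by
    filter_upwards [weight_slice_memLp b] with p hp
    have h1 := hp.2
    rw [eLpNorm_two_eq] at h1
    by_contra hne
    have h2 : ∫⁻ z, ‖b (p.1, z, p.2)‖ₑ ^ (2 : ℝ) ∂ρ = ∞ := not_lt_top_iff.1 hne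
    rw [h2, ENNReal.top_rpow_of_pos (by norm_num)] at h1
    exact lt_irrefl _ h1
  set u : ℝ → α × ℝ → ℝ := fun s => G.indicator fun p => ∫ z, b (p.1, z, p.2) * g s z ∂ρ with hu
  have huc : ∀ p, Continuous fun s => u s p := by
    intro p
    by_cases hp : p ∈ G
    · have e : (fun s => u s p) = fun s => inner ℝ ((hGL p hp).toLp _) (g s) := by
        ext s
        simp only [hu, indicator_of_mem hp]
        rw [L2_inner_eq]
        refine integral_congr_ae ?_
        filter_upwards [(hGL p hp).coeFn_toLp] with z hz
        rw [hz]
      rw [e]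
      exact continuous_const.inner hgc
    · have e : (fun s => u s p) = fun _ => 0 := by
        ext s
        simp only [hu, indicator_of_notMem hp]
      rw [e]
      exact continuous_const
  have hum : ∀ s, StronglyMeasurable (u s) := by
    intro s
    refine StronglyMeasurable.indicator ?_ hGm
    refine StronglyMeasurable.integral_prod_right' (ν := ρ)
      (f := fun q : (α × ℝ) × α => b (q.1.1, q.2, q.1.2) * g s q.2) ?_
    exact hbm.stronglyMeasurable.mul ((Lp.stronglyMeasurable (g s)).comp_measurable measurable_snd)
  have hjoint := stronglyMeasurable_uncurry_of_continuous_of_stronglyMeasurable huc hum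
  have hdiag : StronglyMeasurable fun p : α × ℝ => u p.2 p :=
    hjoint.comp_measurable (measurable_snd.prodMk measurable_id)
  refine hdiag.aestronglyMeasurable.congr ?_
  filter_upwards [hGae, ae_time_mem (ρ := ρ) (T := T)] with p hp hs
  simp only [hu, indicator_of_mem hp]
  rw [hgf p.2 (Ioo_subset_Icc_self hs)]

/-- Cauchy-Schwarz in z, together with the bound of ‖f s‖ on the compact interval. -/
theorem memLp_pairing {f : ℝ → L2 ρ} (hf : ContinuousOn f (Icc 0 T)) (hT : 0 < T)
    (b : L2 (ρ.prod (ρ.prod (timeMeasure T)))) :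
    MemLp (fun p : α × ℝ => ∫ z, b (p.1, z, p.2) * f p.2 z ∂ρ) 2 (ρ.prod (timeMeasure T)) := by
  obtain ⟨C, hC⟩ := isCompact_Icc.exists_bound_of_continuousOn hf
  have hb := (Lp.memLp b).comp_measurePreserving
    (measurePreserving_rearrange (ρ := ρ) (timeMeasure T))
  have hbi : Integrable (fun p : α × ℝ => ∫ z, (b (p.1, z, p.2)) ^ 2 ∂ρ)
      (ρ.prod (timeMeasure T)) := (hb.integrable_sq).integral_prod_left
  rw [memLp_two_iff_integrable_sq (aestronglyMeasurable_pairing hf hT b)]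
  refine Integrable.mono' (hbi.const_mul (C ^ 2))
    ((aestronglyMeasurable_pairing hf hT b).pow 2) ?_
  filter_upwards [weight_slice_memLp b, ae_time_mem (ρ := ρ) (T := T)] with p hp hs
  have e1 : ∫ z, b (p.1, z, p.2) * f p.2 z ∂ρ = inner ℝ (hp.toLp _) (f p.2) := by
    rw [L2_inner_eq]
    refine integral_congr_ae ?_
    filter_upwards [hp.coeFn_toLp] with z hz
    rw [hz]
  have e2 : ∫ z, (b (p.1, z, p.2)) ^ 2 ∂ρ = ‖hp.toLp _‖ ^ 2 := by
    rw [L2_norm_sq_eq]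
    refine integral_congr_ae ?_
    filter_upwards [hp.coeFn_toLp] with z hz
    rw [hz]
  rw [Real.norm_of_nonneg (sq_nonneg _), e1, e2, ← mul_pow, ← sq_abs]
  refine pow_le_pow_left₀ (abs_nonneg _) ?_ 2
  refine (abs_real_inner_le_norm _ _).trans ?_
  rw [mul_comm]
  exact mul_le_mul_of_nonneg_right (hC _ (Ioo_subset_Icc_self hs)) (norm_nonneg _)

end Trajectory

/-! ### Equivalence of the forward problem with the equation for X. -/

section Forward

variable {d : ℕ} {Y : Set (Pt d)} [IsFiniteMeasure (leb Y)] {T : ℝ} {σ : ℝ → ℝ} {L : ℝ≥0}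

theorem IsPreactivation.isForwardSolution (hσ : LipschitzWith L σ) (hT : 0 < T) {a : BiasSpace Y T}
    {b : WeightSpace Y T} {φ : L2 (leb Y)} {X : BiasSpace Y T} (hX : IsPreactivation hσ a b φ X) :
    IsForwardSolution σ T a b φ fun t => φ + kernelOp (nemytskii hσ X) (timeInd T t) := by
  refine ⟨?_, fun t ht => ?_⟩
  · exact (continuous_const.add
      ((kernelOp (nemytskii hσ X)).continuous.comp (continuous_timeInd T))).continuousOn
  have h0 : ∀ᵐ p ∂((leb Y).prod (timeMeasure T)), nemytskii hσ X p =
      σ (a p - ∫ z in Y, b (p.1, z, p.2) * (φ + kernelOp (nemytskii hσ X) (timeInd T p.2)) z) := by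
    have hX' : X = a - (stateOp b φ + volterra b (TimeKernel.causal 0) (nemytskii hσ X)) := by
      conv_lhs => rw [hX]
      abel
    filter_upwards [nemytskii_apply hσ X, stateOp_add_volterra_apply hT b φ (nemytskii hσ X),
      Lp.coeFn_sub a (stateOp b φ + volterra b (TimeKernel.causal 0) (nemytskii hσ X)),
      Lp.coeFn_add (stateOp b φ) (volterra b (TimeKernel.causal 0) (nemytskii hσ X))]
      with p h1 h2 h3 h4
    rw [h1, ← h2]
    congr 1
    rw [← hX', Pi.sub_apply, h4, Pi.add_apply] at h3
    exact h3
  filter_upwards [Lp.coeFn_add φ (kernelOp (nemytskii hσ X) (timeInd T t)),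
    kernelOp_timeInd_eq_causal (nemytskii hσ X) t, Measure.ae_ae_of_ae_prod h0] with y h1 h2 h3
  rw [h1, Pi.add_apply, h2, intervalIntegral_eq_causal ht]
  congr 1
  refine integral_congr_ae ?_
  filter_upwards [h3] with r hr
  rw [hr]

theorem IsForwardSolution.exists_isPreactivation (hσ : LipschitzWith L σ) (hT : 0 < T)
    {a : BiasSpace Y T} {b : WeightSpace Y T} {φ : L2 (leb Y)} {f : ℝ → L2 (leb Y)}
    (hf : IsForwardSolution σ T a b φ f) :
    ∃ X, IsPreactivation hσ a b φ X ∧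
      ∀ t ∈ Icc 0 T, f t = φ + kernelOp (nemytskii hσ X) (timeInd T t) := by
  have hm := (Lp.memLp a).sub (memLp_pairing hf.continuousOn hT b)
  set X : BiasSpace Y T := hm.toLp _ with hX
  have hXa : ∀ᵐ p ∂((leb Y).prod (timeMeasure T)),
      X p = a p - ∫ z in Y, b (p.1, z, p.2) * f p.2 z := hm.coeFn_toLp
  have hft : ∀ t ∈ Icc 0 T, f t = φ + kernelOp (nemytskii hσ X) (timeInd T t) := by
    intro t ht
    refine Lp.ext ?_
    have h0 : ∀ᵐ p ∂((leb Y).prod (timeMeasure T)), nemytskii hσ X p =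
        σ (a p - ∫ z in Y, b (p.1, z, p.2) * f p.2 z) := by
      filter_upwards [nemytskii_apply hσ X, hXa] with p h1 h2
      rw [h1, h2]
    filter_upwards [hf.equation t ht, Lp.coeFn_add φ (kernelOp (nemytskii hσ X) (timeInd T t)),
      kernelOp_timeInd_eq_causal (nemytskii hσ X) t, Measure.ae_ae_of_ae_prod h0] with y h1 h2 h3 h4
    rw [h1, h2, Pi.add_apply, h3, intervalIntegral_eq_causal ht]
    congr 1
    refine integral_congr_ae ?_
    filter_upwards [h4] with r hr
    rw [hr]
  refine ⟨X, ?_, hft⟩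
  have e : a - stateOp b φ - volterra b (TimeKernel.causal 0) (nemytskii hσ X) =
      a - (stateOp b φ + volterra b (TimeKernel.causal 0) (nemytskii hσ X)) := by abel
  unfold IsPreactivation
  rw [e]
  refine Lp.ext ?_
  filter_upwards [hXa, stateOp_add_volterra_apply hT b φ (nemytskii hσ X),
      Lp.coeFn_sub a (stateOp b φ + volterra b (TimeKernel.causal 0) (nemytskii hσ X)),
      Lp.coeFn_add (stateOp b φ) (volterra b (TimeKernel.causal 0) (nemytskii hσ X)),
      ae_time_mem (ρ := leb Y) (T := T)] with p h1 h2 h3 h4 h5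
  rw [h1, h3, Pi.sub_apply, h4, Pi.add_apply, h2, hft p.2 (Ioo_subset_Icc_self h5)]

/-- Existence is what makes the choice operator in `forwardState` return an actual solution. -/
theorem isForwardSolution_forwardState (hσ : LipschitzWith L σ) (hT : 0 < T) (a : BiasSpace Y T)
    (b : WeightSpace Y T) (φ : L2 (leb Y)) :
    IsForwardSolution σ T a b φ (forwardState σ T a b φ) := by
  obtain ⟨X, hX⟩ := exists_isPreactivation hσ a b φ
  exact Classical.epsilon_spec (p := IsForwardSolution σ T a b φ) ⟨_, hX.isForwardSolution hσ hT⟩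

theorem exists_isPreactivation_forwardState (hσ : LipschitzWith L σ) (hT : 0 < T)
    (a : BiasSpace Y T) (b : WeightSpace Y T) (φ : L2 (leb Y)) :
    ∃ X, IsPreactivation hσ a b φ X ∧ ∀ t ∈ Icc 0 T,
      forwardState σ T a b φ t = φ + kernelOp (nemytskii hσ X) (timeInd T t) :=
  (isForwardSolution_forwardState hσ hT a b φ).exists_isPreactivation hσ hT

end Forward

/-! ### Rank-one weight variations. -/

section WeightTensor

variable {α : Type*} [MeasurableSpace α] {ρ : Measure α} [IsFiniteMeasure ρ] {T : ℝ}

theorem measurePreserving_rearrange_symm :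
    MeasurePreserving (fun x : α × α × ℝ => ((x.1, x.2.2), x.2.1))
      (ρ.prod (ρ.prod (timeMeasure T))) ((ρ.prod (timeMeasure T)).prod ρ) := by
  have h1 := (measurePreserving_prodAssoc ρ (timeMeasure T) ρ).symm MeasurableEquiv.prodAssoc
  have h2 : MeasurePreserving (Prod.map id Prod.swap) (ρ.prod (ρ.prod (timeMeasure T)))
      (ρ.prod ((timeMeasure T).prod ρ)) :=
    (MeasurePreserving.id ρ).prod Measure.measurePreserving_swap
  exact h1.comp h2

/-- The weight `b(y, z, s) = ψ(y, s) φ(z)`. -/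
def weightTensor (ψ : L2 (ρ.prod (timeMeasure T))) (φ : L2 ρ) :
    L2 (ρ.prod (ρ.prod (timeMeasure T))) :=
  ((memLp_tensor ψ φ).comp_measurePreserving measurePreserving_rearrange_symm).toLp _

theorem weightTensor_apply (ψ : L2 (ρ.prod (timeMeasure T))) (φ : L2 ρ) :
    weightTensor ψ φ =ᵐ[ρ.prod (ρ.prod (timeMeasure T))] fun x => ψ (x.1, x.2.2) * φ x.2.1 :=
  MemLp.coeFn_toLp _

/-- A rank-one variation ψ ⊗ φ sees a trajectory only through its scalar product with φ; this
reduces the sensitivities to a finite linear system at each time. -/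
theorem stateOp_add_volterra_weightTensor (hT : 0 < T) (ψ : L2 (ρ.prod (timeMeasure T)))
    (φ φ' : L2 ρ) (v : L2 (ρ.prod (timeMeasure T))) :
    ∀ᵐ p ∂(ρ.prod (timeMeasure T)),
      stateOp (weightTensor ψ φ) φ' p + volterra (weightTensor ψ φ) (TimeKernel.causal 0) v p =
        ψ p * inner ℝ φ (φ' + kernelOp v (timeInd T p.2)) := by
  filter_upwards [stateOp_add_volterra_apply hT (weightTensor ψ φ) φ' v,
    ae_slice (weightTensor_apply ψ φ)] with p h1 h2
  rw [h1, L2_inner_eq, ← integral_const_mul]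
  refine integral_congr_ae ?_
  filter_upwards [h2] with z hz
  rw [hz, mul_assoc]

end WeightTensor

/-- The quadratic form of the matrix is (∑ v_j)² + ‖∑ v_j φ_j‖², and weak linear independence says
precisely that it is definite. -/
theorem det_one_add_gram_ne_zero {N : ℕ} {V : Type*} [NormedAddCommGroup V] [InnerProductSpace ℝ V]
    {φ : Fin N → V} (h : WeaklyLinearIndependent φ) :
    (Matrix.of fun k j => 1 + inner ℝ (φ k) (φ j) : Matrix (Fin N) (Fin N) ℝ).det ≠ 0 := by
  intro hdet
  obtain ⟨v, hv, hmv⟩ := Matrix.exists_mulVec_eq_zero_iff.2 hdet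
  have h1 : ∀ k, ∑ j, v j + inner ℝ (φ k) (∑ j, v j • φ j) = 0 := by
    intro k
    have := congrFun hmv k
    simp only [Matrix.mulVec, dotProduct, Matrix.of_apply, Pi.zero_apply, add_mul, one_mul,
      Finset.sum_add_distrib] at this
    rw [inner_sum, ← this]
    congr 1
    refine Finset.sum_congr rfl fun j _ => ?_
    rw [inner_smul_right, mul_comm]
  have h2 : (∑ j, v j) ^ 2 + ‖∑ j, v j • φ j‖ ^ 2 = 0 := by
    have h3 : ∑ k, v k * (∑ j, v j + inner ℝ (φ k) (∑ j, v j • φ j)) = 0 := by simp [h1]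
    rw [← h3, ← real_inner_self_eq_norm_sq, sum_inner, sq, Finset.sum_mul]
    simp only [mul_add, Finset.sum_add_distrib, inner_smul_left]
    simp
  have h4 : ∑ j, v j = 0 := by nlinarith [sq_nonneg (∑ j, v j), sq_nonneg ‖∑ j, v j • φ j‖]
  have h5 : ∑ j, v j • φ j = 0 := by
    rw [← norm_eq_zero]
    nlinarith [sq_nonneg (∑ j, v j), sq_nonneg ‖∑ j, v j • φ j‖]
  exact hv (funext fun j => h v h4 h5 j)

/-! ### Sensitivity of the terminal states with respect to (a, b). -/

section Terminal

variable {d N : ℕ} {Y : Set (Pt d)} [IsFiniteMeasure (leb Y)] {T : ℝ} {σ : ℝ → ℝ} {L : ℝ≥0}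

theorem exists_isPreactivation_terminalState (hσ : LipschitzWith L σ) (hT : 0 < T)
    (fI : Fin N → L2 (leb Y)) (a : BiasSpace Y T) (b : WeightSpace Y T) :
    ∃ X : Fin N → BiasSpace Y T, ∀ j, IsPreactivation hσ a b (fI j) (X j) ∧
      terminalState σ T fI a b j = fI j + timeIntegral (leb Y) T (nemytskii hσ (X j)) := by
  choose X hX using fun j => exists_isPreactivation_forwardState hσ hT a b (fI j)
  exact ⟨X, fun j => ⟨(hX j).1, (hX j).2 T ⟨hT.le, le_rfl⟩⟩⟩

/-- The terminal states depend in a Lipschitz continuous way on the parameters along a line. -/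
theorem eventually_norm_terminalState_sub_le (hσ : LipschitzWith L σ) (hT : 0 < T)
    (fI : Fin N → L2 (leb Y)) (a α' : BiasSpace Y T) (b β : WeightSpace Y T) (j : Fin N) :
    ∃ C, ∀ᶠ t in nhds (0 : ℝ), ‖terminalState σ T fI (a + t • α') (b + t • β) j -
      terminalState σ T fI a b j‖ ≤ C * |t| := by
  obtain ⟨X₀, hX₀⟩ := exists_isPreactivation_terminalState hσ hT fI a b
  choose X hX using fun t : ℝ =>
    exists_isPreactivation_terminalState hσ hT fI (a + t • α') (b + t • β)
  obtain ⟨C, hC⟩ := eventually_norm_nemytskii_sub_le hσ (hX₀ j).1 fun t => (hX t j).1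
  refine ⟨‖timeIntegral (leb Y) T‖ * C, ?_⟩
  filter_upwards [hC] with t ht
  rw [(hX t j).2, (hX₀ j).2, add_sub_add_left_eq_sub, ← map_sub, mul_assoc]
  exact (ContinuousLinearMap.le_opNorm _ _).trans (mul_le_mul_of_nonneg_left ht (norm_nonneg _))

/-- The sensitivities of a linear combination of the terminal states are represented by solutions
of the adjoint equations. -/
theorem exists_adjoint_states (hσ : LipschitzWith L σ) (hd : Differentiable ℝ σ) (hT : 0 < T)
    (fI : Fin N → L2 (leb Y)) (a : BiasSpace Y T) (b : WeightSpace Y T)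
    (X : Fin N → BiasSpace Y T) (hX : ∀ j, IsPreactivation hσ a b (fI j) (X j))
    (g : Fin N → L2 (leb Y))
    (hg : ∀ α' β, HasDerivAt (fun t : ℝ =>
      ∑ j, (inner ℝ (g j) (terminalState σ T fI (a + t • α') (b + t • β) j) : ℝ)) 0 0) :
    ∃ p : Fin N → BiasSpace Y T,
      (∀ j, p j = derivOp hσ (X j) (ContinuousLinearMap.adjoint (timeIntegral (leb Y) T) (g j) -
        ContinuousLinearMap.adjoint (volterra b (TimeKernel.causal 0)) (p j))) ∧
      ∀ α' β, ∑ j, (inner ℝ (p j) (α' - stateOp β (fI j) -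
        volterra β (TimeKernel.causal 0) (nemytskii hσ (X j))) : ℝ) = 0 := by
  choose u hu using fun j => isUnit_one_add_volterra hσ b (X j)
  set S : Fin N → BiasSpace Y T →L[ℝ] BiasSpace Y T := fun j => ((u j)⁻¹ : Units _).val with hS
  have hSu : ∀ j v, S j (v + volterra b (TimeKernel.causal 0) (derivOp hσ (X j) v)) = v := by
    intro j v
    have h1 : S j * (u j).val = 1 := Units.inv_mul (u j)
    rw [hu] at h1
    exact congrArg (fun A : BiasSpace Y T →L[ℝ] BiasSpace Y T => A v) h1
  have huS : ∀ j v, S j v + volterra b (TimeKernel.causal 0) (derivOp hσ (X j) (S j v)) = v := by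
    intro j v
    have h1 : (u j).val * S j = 1 := Units.mul_inv (u j)
    rw [hu] at h1
    exact congrArg (fun A : BiasSpace Y T →L[ℝ] BiasSpace Y T => A v) h1
  -- The sensitivity of f_j(T) is R D S η, with R the time integral, D multiplication by σ'(X_j) and
  -- S the inverse of 1 + VD. So p_j = (R D S)* g_j, and its equation is the dual of S(1 + VD) = 1,
  -- D being self-adjoint.
  refine ⟨fun j => ContinuousLinearMap.adjoint
    ((timeIntegral (leb Y) T).comp ((derivOp hσ (X j)).comp (S j))) (g j), fun j => ?_,
    fun α' β => ?_⟩
  · have hD : ∀ f h, inner ℝ (derivOp hσ (X j) f) h = inner ℝ f (derivOp hσ (X j) h) :=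
      mulOp_inner _ _
    rw [map_sub, eq_sub_iff_add_eq]
    refine ext_inner_right ℝ fun v => ?_
    rw [inner_add_left, hD, hD, ContinuousLinearMap.adjoint_inner_left,
      ContinuousLinearMap.adjoint_inner_left, ContinuousLinearMap.adjoint_inner_left,
      ContinuousLinearMap.adjoint_inner_left, ← inner_add_right]
    congr 1
    rw [← map_add]
    simp only [ContinuousLinearMap.comp_apply]
    rw [hSu]
  · choose Xt hXt using fun t : ℝ =>
      exists_isPreactivation_terminalState hσ hT fI (a + t • α') (b + t • β)
    have h1 := (hg α' β).tendsto_slope_zero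
    have h2 : ∀ j, Filter.Tendsto (fun t : ℝ => (inner ℝ (g j)
        (timeIntegral (leb Y) T (t⁻¹ • (nemytskii hσ (Xt t j) - nemytskii hσ (X j)))) : ℝ))
        (nhdsWithin 0 {0}ᶜ) (nhds (inner ℝ (g j) (timeIntegral (leb Y) T (derivOp hσ (X j)
          (S j (α' - stateOp β (fI j) -
            volterra β (TimeKernel.causal 0) (nemytskii hσ (X j)))))))) := by
      intro j
      have h3 := hasDerivAt_nemytskii hσ hd (hX j) (fun t => (hXt t j).1)
        (huS j (α' - stateOp β (fI j) - volterra β (TimeKernel.causal 0) (nemytskii hσ (X j))))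
      exact tendsto_const_nhds.inner (((timeIntegral (leb Y) T).continuous.tendsto _).comp h3)
    have h4 := tendsto_finsetSum Finset.univ fun j _ => h2 j
    -- `Xt 0` and `X` are chosen independently; the Lipschitz estimate at t = 0 shows that their
    -- velocities agree.
    have hX0 : ∀ j, nemytskii hσ (Xt 0 j) = nemytskii hσ (X j) := by
      intro j
      obtain ⟨C, hC⟩ := eventually_norm_nemytskii_sub_le hσ (hX j) fun t => (hXt t j).1
      have h5 := hC.self_of_nhds
      rw [abs_zero, mul_zero] at h5
      exact sub_eq_zero.1 (norm_le_zero_iff.1 h5)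
    refine Eq.trans (Finset.sum_congr rfl fun j _ => ?_)
      (tendsto_nhds_unique (h4.congr fun t => ?_) h1)
    · rw [ContinuousLinearMap.adjoint_inner_left]
      rfl
    · rw [← Finset.sum_sub_distrib, Finset.smul_sum]
      refine Finset.sum_congr rfl fun j _ => ?_
      rw [map_smul, inner_smul_right, smul_eq_mul, map_sub, zero_add, ← inner_sub_right, (hXt t j).2,
        (hXt 0 j).2, hX0 j, add_sub_add_left_eq_sub]

/-- If no parameter variation changes `∑ⱼ ⟪gⱼ, f⁽ʲ⁾(T)⟫` to first order, then all `gⱼ` vanish. -/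
theorem eq_zero_of_hasDerivAt_terminalState (hσ : LipschitzWith L σ) (hd : Differentiable ℝ σ)
    (hpos : ∀ x, 0 < deriv σ x) (hT : 0 < T) {fI : Fin N → L2 (leb Y)}
    (hfI : WeaklyLinearIndependent fI) (a : BiasSpace Y T) (b : WeightSpace Y T)
    (g : Fin N → L2 (leb Y))
    (hg : ∀ α' β, HasDerivAt (fun t : ℝ =>
      ∑ j, (inner ℝ (g j) (terminalState σ T fI (a + t • α') (b + t • β) j) : ℝ)) 0 0) (i : Fin N) :
    g i = 0 := by
  obtain ⟨X, hX⟩ := exists_isPreactivation_terminalState hσ hT fI a b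
  obtain ⟨p, hp, hpη⟩ := exists_adjoint_states hσ hd hT fI a b X (fun j => (hX j).1) g hg
  set f : Fin N → ℝ → L2 (leb Y) := fun j s =>
    fI j + kernelOp (nemytskii hσ (X j)) (timeInd T s) with hf
  have hfc : ∀ j, Continuous (f j) := fun j =>
    continuous_const.add ((kernelOp (nemytskii hσ (X j))).continuous.comp (continuous_timeInd T))
  have hf0 : ∀ j, f j 0 = fI j := by
    intro j
    have : timeInd T 0 = 0 := by
      rw [Lp.eq_zero_iff_ae_eq_zero]
      filter_upwards [timeInd_apply T 0, ae_restrict_mem measurableSet_Ioo] with r h1 h2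
      rw [h1, if_neg (not_lt.2 h2.1.le), Pi.zero_apply]
    simp only [hf]
    rw [this, map_zero, add_zero]
  set m : Fin N → Fin N → ℝ → ℝ := fun k j s => 1 + inner ℝ (fI k) (f j s) with hm
  have hmc : ∀ k j, Continuous (m k j) := fun k j =>
    continuous_const.add (continuous_const.inner (hfc j))
  have hmm : ∀ k j, Measurable fun p : Pt d × ℝ => m k j p.2 := fun k j =>
    (hmc k j).measurable.comp measurable_snd
  have hmb : ∀ k j, ∃ C, ∀ᵐ p ∂((leb Y).prod (timeMeasure T)), |m k j p.2| ≤ C := by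
    intro k j
    obtain ⟨C, hC⟩ := isCompact_Icc.exists_bound_of_continuousOn (hmc k j).continuousOn (s := Icc 0 T)
    refine ⟨C, ?_⟩
    filter_upwards [ae_time_mem (ρ := leb Y) (T := T)] with p hp
    exact hC _ (Ioo_subset_Icc_self hp)
  choose C hC using hmb
  have hsum : ∀ k, ∑ j, mulOp (hmm k j) (hC k j) (p j) = 0 := by
    intro k
    refine ext_inner_right ℝ fun ψ => ?_
    -- The variation α' = ψ, β = -ψ ⊗ f_I^k changes the equation for X_j by ψ(1 + ⟪f_I^k, f_j(s)⟫) =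
    -- m_kj ψ. The bias supplies the summand 1, which is why weak independence suffices.
    rw [sum_inner, inner_zero_left, ← hpη ψ (weightTensor (-ψ) (fI k))]
    refine Finset.sum_congr rfl fun j _ => ?_
    rw [mulOp_inner]
    congr 1
    rw [sub_sub]
    refine Lp.ext ?_
    set β := weightTensor (-ψ) (fI k)
    filter_upwards [mulOp_apply (hmm k j) (hC k j) ψ,
      stateOp_add_volterra_weightTensor hT (-ψ) (fI k) (fI j) (nemytskii hσ (X j)),
      Lp.coeFn_neg ψ, Lp.coeFn_sub ψ (stateOp β (fI j) +
        volterra β (TimeKernel.causal 0) (nemytskii hσ (X j))),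
      Lp.coeFn_add (stateOp β (fI j)) (volterra β (TimeKernel.causal 0) (nemytskii hσ (X j)))]
      with q h1 h2 h3 h4 h5
    rw [h1, h4, Pi.sub_apply, h5, Pi.add_apply, h2, h3, Pi.neg_apply]
    simp only [hm, hf]
    ring
  set D : ℝ → ℝ := fun s => (Matrix.of fun k j => m k j s : Matrix (Fin N) (Fin N) ℝ).det with hD
  have hDc : Continuous D := by
    refine Continuous.matrix_det ?_
    exact continuous_matrix fun k j => hmc k j
  have hD0 : D 0 ≠ 0 := by
    have := det_one_add_gram_ne_zero hfI
    simpa only [hD, hm, hf0] using this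
  -- The determinant is nonzero at s = 0 and continuous, so for s < t₀ the linear system has only
  -- the zero solution.
  obtain ⟨t₀, ht₀, hball⟩ := Metric.eventually_nhds_iff.1
    (hDc.continuousAt.eventually_ne hD0)
  refine eq_zero_of_adjoint_eq_zero_near_zero hT hσ hpos b (X i) (hp i) ht₀ ?_
  have hae : ∀ k, ∀ᵐ x ∂((leb Y).prod (timeMeasure T)), ∑ j, m k j x.2 * p j x = 0 := by
    intro k
    have h1 := (Lp.eq_zero_iff_ae_eq_zero).1 (hsum k)
    have h2 : ∀ᵐ x ∂((leb Y).prod (timeMeasure T)), ∀ j,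
        mulOp (hmm k j) (hC k j) (p j) x = m k j x.2 * p j x :=
      ae_all_iff.2 fun j => mulOp_apply (hmm k j) (hC k j) (p j)
    filter_upwards [h1, h2, Lp.coeFn_finsetSum Finset.univ fun j => mulOp (hmm k j) (hC k j) (p j)]
      with x h3 h4 h5
    rw [h5, Finset.sum_apply, Pi.zero_apply] at h3
    rw [← h3]
    exact Finset.sum_congr rfl fun j _ => (h4 j).symm
  filter_upwards [ae_all_iff.2 hae, ae_time_mem (ρ := leb Y) (T := T)] with x h1 h2 h3
  have h4 : D x.2 ≠ 0 := by
    refine hball ?_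
    rw [Real.dist_eq, sub_zero, abs_of_pos h2.1]
    exact h3
  have h5 := Matrix.eq_zero_of_mulVec_eq_zero h4 (v := fun j => p j x) (funext fun k => h1 k)
  exact congrFun h5 i

end Terminal

/-! ### Expansion of w in the orthonormal system, and variations in (w, μ). -/

section Expansion

variable {d l N K : ℕ} {Y : Set (Pt d)} {U : Set (Pt l)}

theorem kernelOp_sum {α β ι : Type*} [MeasurableSpace α] [MeasurableSpace β] {ρ : Measure α}
    {ν : Measure β} [SFinite ρ] [SFinite ν] (S : Finset ι) (k : ι → L2 (ρ.prod ν)) (φ : L2 ν) :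
    kernelOp (∑ i ∈ S, k i) φ = ∑ i ∈ S, kernelOp (k i) φ :=
  map_sum (AddMonoidHom.mk' (fun k : L2 (ρ.prod ν) => kernelOp k φ)
    fun k k' => kernelOp_add k k' φ) k S

theorem kernelOp_sum_tensor_orthonormal {s : Fin K → L2 (leb Y)} (hs : Orthonormal ℝ s)
    (c : Fin K → L2 (leb U)) (k : Fin K) :
    kernelOp (∑ j, tensor (c j) (s j)) (s k) = c k := by
  rw [kernelOp_sum]
  simp only [kernelOp_tensor]
  rw [Finset.sum_eq_single k]
  · rw [real_inner_self_eq_norm_sq, hs.1 k, one_pow, one_smul]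
  · intro j _ hjk
    rw [hs.2 hjk, zero_smul]
  · simp

theorem coeFn_sum_tensor_add (s : Fin K → L2 (leb Y)) (c : Fin K → L2 (leb U))
    (hw : TerminalWeightSpace U Y) :
    ∀ᵐ p ∂((leb U).prod (leb Y)),
      (∑ j, tensor (c j) (s j) + hw : TerminalWeightSpace U Y) p =
        ∑ j, c j p.1 * s j p.2 + hw p := by
  have h : ∀ᵐ p ∂((leb U).prod (leb Y)), ∀ j, tensor (c j) (s j) p = c j p.1 * s j p.2 :=
    ae_all_iff.2 fun j => tensor_apply (c j) (s j)
  filter_upwards [h, Lp.coeFn_add (∑ j, tensor (c j) (s j)) hw,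
    Lp.coeFn_finsetSum Finset.univ fun j => tensor (c j) (s j)] with p h1 h2 h3
  rw [h2, Pi.add_apply, h3, Finset.sum_apply]
  simp only [h1]

theorem kernelOp_eq_zero_iff (hw : TerminalWeightSpace U Y) (s : Fin K → L2 (leb Y)) :
    (∀ᵐ u ∂(leb U), ∀ j, ∫ y in Y, hw (u, y) * s j y = 0) ↔ ∀ j, kernelOp hw (s j) = 0 := by
  rw [ae_all_iff]
  refine forall_congr' fun j => ?_
  rw [Lp.eq_zero_iff_ae_eq_zero]
  constructor
  · intro h
    filter_upwards [h, kernelOp_apply hw (s j)] with u h1 h2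
    rw [h2, h1, Pi.zero_apply]
  · intro h
    filter_upwards [h, kernelOp_apply hw (s j)] with u h1 h2
    rw [← h2, h1, Pi.zero_apply]

/-- Applying the operator to s_k extracts the k-th coefficient, so an expansion always exists and
its coefficients are forced to be W s_k. -/
theorem hasExpansion_iff {s : Fin K → L2 (leb Y)} (hs : Orthonormal ℝ s)
    (w : TerminalWeightSpace U Y) (c : Fin K → L2 (leb U)) :
    HasExpansion w s c ↔ c = fun k => kernelOp w (s k) := by
  constructor
  · rintro ⟨hw, h1, h2⟩
    rw [kernelOp_eq_zero_iff] at h2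
    have e : w = ∑ j, tensor (c j) (s j) + hw := by
      refine Lp.ext ?_
      filter_upwards [h1, coeFn_sum_tensor_add s c hw] with p h3 h4
      rw [h3, h4]
    funext k
    rw [e, kernelOp_add, kernelOp_sum_tensor_orthonormal hs, h2, add_zero]
  · intro hc
    refine ⟨w - ∑ j, tensor (c j) (s j), ?_, (kernelOp_eq_zero_iff _ s).2 fun k => ?_⟩
    · have h := coeFn_sum_tensor_add s c (w - ∑ j, tensor (c j) (s j))
      rwa [add_sub_cancel] at h
    · have h := kernelOp_add (w - ∑ j, tensor (c j) (s j)) (∑ j, tensor (c j) (s j)) (s k)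
      rw [sub_add_cancel, kernelOp_sum_tensor_orthonormal hs, hc] at h
      simpa [hc] using h

theorem coeffMatrix_apply (F : Fin N → L2 (leb Y)) (s : Fin K → L2 (leb Y)) (j : Fin N)
    (k : Fin K) : coeffMatrix F s j k = inner ℝ (s k) (F j) := by
  rw [real_inner_comm, L2_inner_eq]
  rfl

/-- A full orthonormal system in the span of `F` expands every `F j`. -/
theorem eq_sum_coeffMatrix (F : Fin N → L2 (leb Y)) {s : Fin K → L2 (leb Y)}
    (hs : Orthonormal ℝ s) (hK : K = finrank ℝ (Submodule.span ℝ (range F)))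
    (hmem : ∀ k, s k ∈ Submodule.span ℝ (range F)) (j : Fin N) :
    F j = ∑ k, coeffMatrix F s j k • s k := by
  have hle : Submodule.span ℝ (range s) ≤ Submodule.span ℝ (range F) :=
    Submodule.span_le.2 (by rintro _ ⟨k, rfl⟩; exact hmem k)
  have hfin : finrank ℝ (Submodule.span ℝ (range s)) = K := by
    rw [finrank_span_eq_card hs.linearIndependent, Fintype.card_fin]
  have : FiniteDimensional ℝ (Submodule.span ℝ (range F)) :=
    FiniteDimensional.span_of_finite ℝ (finite_range F)
  -- K orthonormal vectors in a space of dimension K span it.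
  have heq := Submodule.eq_of_le_of_finrank_eq hle (hfin.trans hK)
  have hj : F j ∈ Submodule.span ℝ (range s) := heq ▸ Submodule.subset_span ⟨j, rfl⟩
  obtain ⟨c, hc⟩ := (Submodule.mem_span_range_iff_exists_fun ℝ).1 hj
  have hck : ∀ k, coeffMatrix F s j k = c k := by
    intro k
    rw [coeffMatrix_apply, ← hc, hs.inner_right_fintype]
  simp only [hck, hc]

/-- Testing with w' = 0 isolates ∑ r_j; testing with w' = ψ ⊗ s_k and μ' = 0 isolates the k-th
weighted sum. These tests suffice because every F j lies in the span of the s_k. -/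
theorem sum_smul_inner_iff (F : Fin N → L2 (leb Y)) {s : Fin K → L2 (leb Y)}
    (hF : ∀ j, F j = ∑ k, coeffMatrix F s j k • s k) (r : Fin N → L2 (leb U)) :
    (∀ (w' : TerminalWeightSpace U Y) (μ' : L2 (leb U)),
      ∑ j, (inner ℝ (r j) (kernelOp w' (F j) + μ') : ℝ) = 0) ↔
    ∑ j, r j = 0 ∧ ∀ k, ∑ j, coeffMatrix F s j k • r j = 0 := by
  constructor
  · intro h
    have h1 : ∀ μ', ∑ j, (inner ℝ (r j) μ' : ℝ) = 0 := by
      intro μ'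
      have := h 0 μ'
      have h0 : ∀ φ : L2 (leb Y), kernelOp (0 : TerminalWeightSpace U Y) φ = 0 := fun φ => by
        simpa using kernelOp_smul (0 : ℝ) (0 : TerminalWeightSpace U Y) φ
      simpa only [h0, zero_add] using this
    refine ⟨ext_inner_right ℝ fun ψ => by rw [sum_inner, h1, inner_zero_left], fun k => ?_⟩
    refine ext_inner_right ℝ fun ψ => ?_
    have h2 := h (tensor ψ (s k)) 0
    rw [sum_inner, inner_zero_left, ← h2]
    refine Finset.sum_congr rfl fun j _ => ?_
    rw [add_zero, kernelOp_tensor, inner_smul_right, inner_smul_left, coeffMatrix_apply]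
    simp
  · rintro ⟨h1, h2⟩ w' μ'
    have h3 : ∑ j, (inner ℝ (r j) (kernelOp w' (F j)) : ℝ) = 0 := by
      have h4 : ∀ j, (inner ℝ (r j) (kernelOp w' (F j)) : ℝ) =
          ∑ k, inner ℝ (coeffMatrix F s j k • r j) (kernelOp w' (s k)) := by
        intro j
        conv_lhs => rw [hF j]
        rw [map_sum, inner_sum]
        refine Finset.sum_congr rfl fun k _ => ?_
        rw [map_smul, inner_smul_right, inner_smul_left]
        simp
      simp only [h4]
      rw [Finset.sum_comm]
      refine Finset.sum_eq_zero fun k _ => ?_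
      rw [← sum_inner, h2, inner_zero_left]
    simp only [inner_add_right, Finset.sum_add_distrib]
    rw [h3, ← sum_inner, h1, inner_zero_left, add_zero]

end Expansion

/-! ### The finite-dimensional normal equations. -/

section NormalSystem

variable {N K : ℕ}

theorem sum_unitVec_mul (x : Fin N → ℝ) : unitVec N ⬝ᵥ x = 1 / Real.sqrt N * ∑ j, x j := by
  simp only [dotProduct, unitVec, Finset.mul_sum]

theorem centering_mulVec (x : Fin N → ℝ) (j : Fin N) :
    ((1 - Matrix.vecMulVec (unitVec N) (unitVec N)) *ᵥ x) j = x j - 1 / (N : ℝ) * ∑ i, x i := by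
  rw [Matrix.sub_mulVec, Matrix.one_mulVec, Pi.sub_apply]
  congr 1
  have h1 : (Matrix.vecMulVec (unitVec N) (unitVec N) *ᵥ x) j =
      unitVec N j * (unitVec N ⬝ᵥ x) := by
    simp only [Matrix.mulVec, dotProduct, Matrix.vecMulVec_apply, Finset.mul_sum, mul_assoc]
  rw [h1, sum_unitVec_mul, unitVec, ← mul_assoc, div_mul_div_comm, one_mul,
    Real.mul_self_sqrt (Nat.cast_nonneg N)]

/-- Subtracting the mean is the orthogonal projection onto the complement of the constants; N > 0
makes ẽ a unit vector. -/
theorem centering_transpose_mul_self (hN : 0 < N) :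
    (1 - Matrix.vecMulVec (unitVec N) (unitVec N))ᵀ *
      (1 - Matrix.vecMulVec (unitVec N) (unitVec N)) =
      1 - Matrix.vecMulVec (unitVec N) (unitVec N) := by
  have hN' : (N : ℝ) ≠ 0 := Nat.cast_ne_zero.2 hN.ne'
  have ht : (1 - Matrix.vecMulVec (unitVec N) (unitVec N))ᵀ =
      1 - Matrix.vecMulVec (unitVec N) (unitVec N) := by
    rw [Matrix.transpose_sub, Matrix.transpose_one, Matrix.transpose_vecMulVec]
  rw [ht]
  refine Matrix.ext_of_mulVec_single fun i => ?_
  rw [← Matrix.mulVec_mulVec]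
  funext j
  rw [centering_mulVec]
  simp only [centering_mulVec, Finset.sum_sub_distrib, Finset.sum_const, Finset.card_univ,
    Fintype.card_fin, nsmul_eq_mul]
  field_simp
  ring

/-- For the residual `Ω c + μ - P`, orthogonality to the constants and to the columns of `Ω` is
equivalent to the centered normal system together with the formula for `μ`. -/
theorem residual_orthogonal_iff (hN : 0 < N) (Ω : Matrix (Fin N) (Fin K) ℝ) (c : Fin K → ℝ)
    (P : Fin N → ℝ) (μ : ℝ) :
    (∑ j, ((Ω *ᵥ c) j + μ - P j) = 0 ∧ ∀ k, ∑ j, Ω j k * ((Ω *ᵥ c) j + μ - P j) = 0) ↔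
      (((1 - Matrix.vecMulVec (unitVec N) (unitVec N)) * Ω)ᵀ *
          ((1 - Matrix.vecMulVec (unitVec N) (unitVec N)) * Ω)) *ᵥ c =
        ((1 - Matrix.vecMulVec (unitVec N) (unitVec N)) * Ω)ᵀ *ᵥ P ∧
      μ = 1 / Real.sqrt N * (P ⬝ᵥ unitVec N - unitVec N ⬝ᵥ (Ω *ᵥ c)) := by
  have hN' : (N : ℝ) ≠ 0 := Nat.cast_ne_zero.2 hN.ne'
  set x : Fin N → ℝ := Ω *ᵥ c - P with hx
  have hxj : ∀ j, (Ω *ᵥ c) j + μ - P j = x j + μ := by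
    intro j
    rw [hx, Pi.sub_apply]
    ring
  have hbias : μ = 1 / Real.sqrt N * (P ⬝ᵥ unitVec N - unitVec N ⬝ᵥ (Ω *ᵥ c)) ↔
      μ = -(1 / (N : ℝ) * ∑ j, x j) := by
    rw [dotProduct_comm, sum_unitVec_mul, sum_unitVec_mul, ← mul_sub, ← mul_assoc,
      div_mul_div_comm, one_mul, Real.mul_self_sqrt (Nat.cast_nonneg N), ← Finset.sum_sub_distrib,
      ← mul_neg, ← Finset.sum_neg_distrib]
    simp only [hx, Pi.sub_apply, neg_sub]
  have hsum : ∑ j, (x j + μ) = 0 ↔ μ = -(1 / (N : ℝ) * ∑ j, x j) := by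
    rw [Finset.sum_add_distrib, Finset.sum_const, Finset.card_univ, Fintype.card_fin,
      nsmul_eq_mul]
    constructor
    · intro h
      field_simp
      linarith
    · intro h
      rw [h]
      field_simp
      ring
  have hnormal : (((1 - Matrix.vecMulVec (unitVec N) (unitVec N)) * Ω)ᵀ *
          ((1 - Matrix.vecMulVec (unitVec N) (unitVec N)) * Ω)) *ᵥ c =
        ((1 - Matrix.vecMulVec (unitVec N) (unitVec N)) * Ω)ᵀ *ᵥ P ↔
      ∀ k, ∑ j, Ω j k * (x j - 1 / (N : ℝ) * ∑ i, x i) = 0 := by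
    set Q := (1 - Matrix.vecMulVec (unitVec N) (unitVec N) : Matrix (Fin N) (Fin N) ℝ) with hQ
    have hQQ : Qᵀ * Q = Q := centering_transpose_mul_self hN
    have hQt : Qᵀ = Q := by
      rw [← hQQ, Matrix.transpose_mul, Matrix.transpose_transpose]
    -- As Q is an orthogonal projection, the centered normal system says that the columns of Ω are
    -- orthogonal to x minus its mean, that is, to the residual once μ is eliminated.
    have e : ((Q * Ω)ᵀ * (Q * Ω)) *ᵥ c - (Q * Ω)ᵀ *ᵥ P = Ωᵀ *ᵥ (Q *ᵥ x) := by
      rw [Matrix.transpose_mul, Matrix.mul_assoc, ← Matrix.mul_assoc Qᵀ, hQQ, hQt, hx,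
        Matrix.mulVec_sub, Matrix.mulVec_sub]
      simp only [Matrix.mulVec_mulVec]
    rw [← sub_eq_zero, e, funext_iff]
    refine forall_congr' fun k => ?_
    simp only [Matrix.mulVec, dotProduct, Matrix.transpose_apply, Pi.zero_apply]
    refine Eq.congr (Finset.sum_congr rfl fun j _ => ?_) rfl
    congr 1
    exact centering_mulVec x j
  simp only [hxj]
  rw [hbias, hsum, hnormal, and_comm]
  refine and_congr_left fun h => forall_congr' fun k => ?_
  rw [h]
  simp only [sub_eq_add_neg]

end NormalSystem

/-! ### First order conditions for the loss. -/

section Loss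

variable {d l N K : ℕ} {Y : Set (Pt d)} {U : Set (Pt l)} {T : ℝ} {σ h : ℝ → ℝ} {L : ℝ≥0}

theorem loss_eq (hh : ∀ ξ, h ξ = ξ) (fI : Fin N → L2 (leb Y)) (P : Fin N → L2 (leb U))
    (x : ControlSpace Y U T) :
    loss σ h T fI P x = 1 / (2 * (N : ℝ)) * ∑ j,
      ‖kernelOp x.2.2.1 (terminalState σ T fI x.1 x.2.1 j) + x.2.2.2 - P j‖ ^ 2 := by
  unfold loss
  congr 1
  refine Finset.sum_congr rfl fun j _ => ?_
  rw [L2_norm_sq_eq]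
  refine integral_congr_ae ?_
  set F := terminalState σ T fI x.1 x.2.1 j
  filter_upwards [kernelOp_apply x.2.2.1 F, Lp.coeFn_add (kernelOp x.2.2.1 F) x.2.2.2,
    Lp.coeFn_sub (kernelOp x.2.2.1 F + x.2.2.2) (P j)] with u h1 h2 h3
  rw [h3, Pi.sub_apply, h2, Pi.add_apply, h1, hh, sq_abs]
  rfl

/-- First order expansion of the loss, in terms of the variation of the terminal states. -/
theorem loss_expansion [IsFiniteMeasure (leb Y)] (hσ : LipschitzWith L σ) (hT : 0 < T)
    (hh : ∀ ξ, h ξ = ξ) (fI : Fin N → L2 (leb Y)) (P : Fin N → L2 (leb U))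
    (a α' : BiasSpace Y T) (b β : WeightSpace Y T) (w w' : TerminalWeightSpace U Y)
    (μ μ' : L2 (leb U)) {F : Fin N → L2 (leb Y)} (hF : F = terminalState σ T fI a b)
    {r : Fin N → L2 (leb U)} (hr : r = fun j => kernelOp w (F j) + μ - P j) :
    (fun t : ℝ => loss σ h T fI P (a + t • α', b + t • β, w + t • w', μ + t • μ') -
      1 / (2 * (N : ℝ)) * ∑ j, ‖r j‖ ^ 2 -
      1 / (N : ℝ) * (∑ j, (inner ℝ (ContinuousLinearMap.adjoint (kernelOp w) (r j))
        (terminalState σ T fI (a + t • α') (b + t • β) j - F j) : ℝ) +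
        t * ∑ j, (inner ℝ (r j) (kernelOp w' (F j) + μ') : ℝ)))
      =o[nhds 0] fun t : ℝ => t := by
  set Δ : ℝ → Fin N → L2 (leb Y) := fun t j =>
    terminalState σ T fI (a + t • α') (b + t • β) j - F j with hΔ
  set e : ℝ → Fin N → L2 (leb U) := fun t j =>
    kernelOp w (Δ t j) + t • (kernelOp w' (F j) + μ' + kernelOp w' (Δ t j)) with he
  have hΔO : ∀ j, (fun t => Δ t j) =O[nhds 0] fun t : ℝ => t := by
    intro j
    obtain ⟨C, hC⟩ := eventually_norm_terminalState_sub_le hσ hT fI a α' b β j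
    refine Asymptotics.IsBigO.of_bound C ?_
    simpa only [hΔ, hF, Real.norm_eq_abs] using hC
  have hidO : (fun t : ℝ => t) =O[nhds 0] fun _ : ℝ => (1 : ℝ) :=
    (continuous_id.tendsto (0 : ℝ)).isBigO_one ℝ
  have hw'O : ∀ j, (fun t => kernelOp w' (Δ t j)) =O[nhds 0] fun t : ℝ => t := fun j =>
    ((kernelOp w').isBigO_comp _ _).trans (hΔO j)
  have heO : ∀ j, (fun t => e t j) =O[nhds 0] fun t : ℝ => t := by
    intro j
    refine (((kernelOp w).isBigO_comp _ _).trans (hΔO j)).add ?_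
    have h1 : (fun t => kernelOp w' (F j) + μ' + kernelOp w' (Δ t j)) =O[nhds 0]
        fun _ : ℝ => (1 : ℝ) :=
      (Asymptotics.isBigO_const_const _ one_ne_zero _).add ((hw'O j).trans hidO)
    simpa using (Asymptotics.isBigO_refl (fun t : ℝ => t) (nhds 0)).smul h1
  -- Lipschitz dependence of the terminal states already gives an O(t²) remainder; their
  -- differentiability is not needed here.
  have hrem : (fun t : ℝ => 1 / (2 * (N : ℝ)) * ∑ j, ‖e t j‖ ^ 2 +
      1 / (N : ℝ) * (t * ∑ j, (inner ℝ (r j) (kernelOp w' (Δ t j)) : ℝ))) =O[nhds 0]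
      fun t : ℝ => t ^ 2 := by
    refine Asymptotics.IsBigO.add ?_ ?_
    · refine (Asymptotics.IsBigO.fun_sum fun j _ => ?_).const_mul_left _
      exact (heO j).norm_left.pow 2
    · refine Asymptotics.IsBigO.const_mul_left ?_ _
      simp only [sq]
      refine (Asymptotics.isBigO_refl _ _).mul (Asymptotics.IsBigO.fun_sum fun j _ => ?_)
      exact ((innerSL ℝ (r j)).isBigO_comp _ _).trans (hw'O j)
  have hsq : (fun t : ℝ => t ^ 2) =o[nhds 0] fun t : ℝ => t := by
    simpa using Asymptotics.isLittleO_pow_pow (𝕜 := ℝ) (m := 1) (n := 2) one_lt_two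
  refine (hrem.trans_isLittleO hsq).congr_left fun t => ?_
  rw [loss_eq hh]
  have hres : ∀ j, kernelOp (w + t • w') (terminalState σ T fI (a + t • α') (b + t • β) j) +
      (μ + t • μ') - P j = r j + e t j := by
    intro j
    have h1 : terminalState σ T fI (a + t • α') (b + t • β) j = F j + Δ t j := by simp [hΔ]
    rw [h1, kernelOp_add_smul, map_add, map_add, hr]
    simp only [he]
    module
  simp only [hres]
  have hexp : ∀ j, ‖r j + e t j‖ ^ 2 = ‖r j‖ ^ 2 + 2 *
      ((inner ℝ (ContinuousLinearMap.adjoint (kernelOp w) (r j)) (Δ t j) : ℝ) +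
        t * inner ℝ (r j) (kernelOp w' (F j) + μ') +
        t * inner ℝ (r j) (kernelOp w' (Δ t j))) + ‖e t j‖ ^ 2 := by
    intro j
    rw [norm_add_sq_real, ContinuousLinearMap.adjoint_inner_left]
    congr 3
    simp only [he]
    rw [inner_add_right, inner_smul_right, inner_add_right]
    ring
  simp only [hexp, Finset.sum_add_distrib, ← Finset.mul_sum]
  rw [show 1 / (2 * (N : ℝ)) = 1 / 2 * (1 / N) by rw [div_mul_div_comm, one_mul]]
  ring

/-- By `loss_expansion`, the increments of the loss and of 1/N times this linearized function differ
by o(t), so each has derivative zero exactly when the other does. -/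
theorem isCriticalPoint_loss_iff_hasDerivAt [IsFiniteMeasure (leb Y)] (hN : 0 < N)
    (hσ : LipschitzWith L σ) (hT : 0 < T)
    (hh : ∀ ξ, h ξ = ξ) (fI : Fin N → L2 (leb Y)) (P : Fin N → L2 (leb U))
    (a : BiasSpace Y T) (b : WeightSpace Y T) (w : TerminalWeightSpace U Y)
    (μ : L2 (leb U)) {F : Fin N → L2 (leb Y)} (hF : F = terminalState σ T fI a b)
    {r : Fin N → L2 (leb U)} (hr : r = fun j => kernelOp w (F j) + μ - P j) :
    IsCriticalPoint (loss σ h T fI P) ((a, b, w, μ) : ControlSpace Y U T) ↔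
      ∀ α' β w' μ', HasDerivAt (fun t : ℝ =>
        ∑ j, (inner ℝ (ContinuousLinearMap.adjoint (kernelOp w) (r j))
          (terminalState σ T fI (a + t • α') (b + t • β) j) : ℝ) +
        t * ∑ j, (inner ℝ (r j) (kernelOp w' (F j) + μ') : ℝ)) 0 0 := by
  have hN' : (N : ℝ) ≠ 0 := Nat.cast_ne_zero.2 hN.ne'
  have key : ∀ α' β w' μ', HasLineDerivAt ℝ (loss σ h T fI P) 0
      ((a, b, w, μ) : ControlSpace Y U T) (α', β, w', μ') ↔ HasDerivAt (fun t : ℝ =>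
        ∑ j, (inner ℝ (ContinuousLinearMap.adjoint (kernelOp w) (r j))
          (terminalState σ T fI (a + t • α') (b + t • β) j) : ℝ) +
        t * ∑ j, (inner ℝ (r j) (kernelOp w' (F j) + μ') : ℝ)) 0 0 := by
    intro α' β w' μ'
    set G : ℝ → ℝ := fun t =>
        ∑ j, (inner ℝ (ContinuousLinearMap.adjoint (kernelOp w) (r j))
          (terminalState σ T fI (a + t • α') (b + t • β) j) : ℝ) +
        t * ∑ j, (inner ℝ (r j) (kernelOp w' (F j) + μ') : ℝ) with hG
    set J : ℝ → ℝ := fun t => loss σ h T fI P (a + t • α', b + t • β, w + t • w', μ + t • μ')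
      with hJ
    have hexp := loss_expansion hσ hT hh fI P a α' b β w w' μ μ' hF hr
    have hJG : (fun t => J t - J 0 - 1 / (N : ℝ) * (G t - G 0)) =o[nhds 0] fun t : ℝ => t := by
      refine hexp.congr_left fun t => ?_
      have hJ0 : J 0 = 1 / (2 * (N : ℝ)) * ∑ j, ‖r j‖ ^ 2 := by
        simp only [hJ, zero_smul, add_zero]
        rw [loss_eq hh, hr, hF]
      have hG0 : G 0 = ∑ j, (inner ℝ (ContinuousLinearMap.adjoint (kernelOp w) (r j)) (F j) : ℝ) := by
        simp only [hG, zero_smul, add_zero, zero_mul, hF]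
      rw [hJ0, hG0]
      simp only [hG, inner_sub_right, Finset.sum_sub_distrib]
      ring
    change HasDerivAt J 0 0 ↔ _
    rw [hasDerivAt_iff_isLittleO_nhds_zero, hasDerivAt_iff_isLittleO_nhds_zero]
    simp only [zero_add, smul_zero, sub_zero]
    constructor
    · intro hJo
      refine ((hJo.sub hJG).const_mul_left (N : ℝ)).congr_left fun t => ?_
      field_simp
      ring
    · intro hGo
      refine (hJG.add (hGo.const_mul_left (1 / (N : ℝ)))).congr_left fun t => ?_
      ring
  constructor
  · intro hc α' β w' μ'
    exact (key α' β w' μ').1 (hc _)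
  · rintro hc ⟨α', β, w', μ'⟩
    exact (key α' β w' μ').2 (hc α' β w' μ')

/-- The first order conditions in the form of normal equations. -/
theorem isCriticalPoint_loss_iff [IsFiniteMeasure (leb Y)] (hN : 0 < N)
    (hσ : LipschitzWith L σ) (hd : Differentiable ℝ σ) (hpos : ∀ x, 0 < deriv σ x) (hT : 0 < T)
    (hh : ∀ ξ, h ξ = ξ) (fI : Fin N → L2 (leb Y)) (P : Fin N → L2 (leb U))
    (hfI : WeaklyLinearIndependent fI)
    (a : BiasSpace Y T) (b : WeightSpace Y T) (w : TerminalWeightSpace U Y)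
    (μ : L2 (leb U)) {F : Fin N → L2 (leb Y)} (hF : F = terminalState σ T fI a b)
    {r : Fin N → L2 (leb U)} (hr : r = fun j => kernelOp w (F j) + μ - P j) :
    IsCriticalPoint (loss σ h T fI P) ((a, b, w, μ) : ControlSpace Y U T) ↔
      (∀ j, ContinuousLinearMap.adjoint (kernelOp w) (r j) = 0) ∧
      ∀ (w' : TerminalWeightSpace U Y) (μ' : L2 (leb U)),
        ∑ j, (inner ℝ (r j) (kernelOp w' (F j) + μ') : ℝ) = 0 := by
  rw [isCriticalPoint_loss_iff_hasDerivAt hN hσ hT hh fI P a b w μ hF hr]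
  constructor
  · intro hc
    refine ⟨?_, fun w' μ' => ?_⟩
    · refine eq_zero_of_hasDerivAt_terminalState hσ hd hpos hT hfI a b _ fun α' β => ?_
      have h0 := hc α' β 0 0
      have h1 : ∀ φ : L2 (leb Y), kernelOp (0 : TerminalWeightSpace U Y) φ = 0 := fun φ => by
        simpa using kernelOp_smul (0 : ℝ) (0 : TerminalWeightSpace U Y) φ
      simpa only [h1, add_zero, inner_zero_right, Finset.sum_const_zero, mul_zero] using h0
    -- With (a, b) fixed the function is affine in t, and its slope is the required sum.
    · have h0 := hc 0 0 w' μ'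
      simp only [smul_zero, add_zero] at h0
      have h1 := ((hasDerivAt_id (0 : ℝ)).mul_const
        (∑ j, (inner ℝ (r j) (kernelOp w' (F j) + μ') : ℝ))).const_add
        (∑ j, (inner ℝ (ContinuousLinearMap.adjoint (kernelOp w) (r j))
          (terminalState σ T fI a b j) : ℝ))
      simpa using h1.unique h0
  · rintro ⟨hg, hw⟩ α' β w' μ'
    simp only [hg, hw, inner_zero_left, Finset.sum_const_zero, mul_zero, add_zero]
    exact hasDerivAt_const _ _

/-- Orthogonality of the residuals, expressed by the normal system for the classifiers. -/
theorem residual_sums_eq_zero_iff (hN : 0 < N) (F : Fin N → L2 (leb Y)) {s : Fin K → L2 (leb Y)}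
    (hF : ∀ j, F j = ∑ k, coeffMatrix F s j k • s k) (P : Fin N → L2 (leb U))
    (w : TerminalWeightSpace U Y) (μ : L2 (leb U)) {r : Fin N → L2 (leb U)}
    (hr : r = fun j => kernelOp w (F j) + μ - P j) :
    (∑ j, r j = 0 ∧ ∀ k, ∑ j, coeffMatrix F s j k • r j = 0) ↔
      SolvesNormalSystem F s P (fun k => kernelOp w (s k)) ∧
        BiasFormula F s P (fun k => kernelOp w (s k)) μ := by
  have hrj : ∀ᵐ u ∂(leb U), ∀ j, r j u =
      (coeffMatrix F s *ᵥ fun k => kernelOp w (s k) u) j + μ u - P j u := by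
    refine ae_all_iff.2 fun j => ?_
    have h1 : kernelOp w (F j) = ∑ k, coeffMatrix F s j k • kernelOp w (s k) := by
      conv_lhs => rw [hF j]
      simp only [map_sum, map_smul]
    have h2 : ∀ᵐ u ∂(leb U), ∀ k, (coeffMatrix F s j k • kernelOp w (s k)) u =
        coeffMatrix F s j k * kernelOp w (s k) u :=
      ae_all_iff.2 fun k => Lp.coeFn_smul (coeffMatrix F s j k) (kernelOp w (s k))
    filter_upwards [h2, Lp.coeFn_sub (kernelOp w (F j) + μ) (P j),
      Lp.coeFn_add (kernelOp w (F j)) μ,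
      Lp.coeFn_finsetSum Finset.univ fun k => coeffMatrix F s j k • kernelOp w (s k)]
      with u h3 h4 h5 h6
    rw [hr]
    simp only
    rw [h4, Pi.sub_apply, h5, Pi.add_apply, h1, h6, Finset.sum_apply]
    simp only [h3]
    rfl
  have hE1 : ∑ j, r j = 0 ↔ ∀ᵐ u ∂(leb U), ∑ j, r j u = 0 := by
    rw [Lp.eq_zero_iff_ae_eq_zero]
    refine Filter.eventually_congr ?_
    filter_upwards [Lp.coeFn_finsetSum Finset.univ r] with u h1
    rw [h1, Finset.sum_apply, Pi.zero_apply]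
  have hE2 : ∀ k, ∑ j, coeffMatrix F s j k • r j = 0 ↔
      ∀ᵐ u ∂(leb U), ∑ j, coeffMatrix F s j k * r j u = 0 := by
    intro k
    rw [Lp.eq_zero_iff_ae_eq_zero]
    refine Filter.eventually_congr ?_
    have h2 : ∀ᵐ u ∂(leb U), ∀ j, (coeffMatrix F s j k • r j) u = coeffMatrix F s j k * r j u :=
      ae_all_iff.2 fun j => Lp.coeFn_smul (coeffMatrix F s j k) (r j)
    filter_upwards [Lp.coeFn_finsetSum Finset.univ fun j => coeffMatrix F s j k • r j, h2]
      with u h1 h3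
    rw [h1, Finset.sum_apply, Pi.zero_apply]
    simp only [h3]
  unfold SolvesNormalSystem BiasFormula
  simp only [hE1, hE2]
  -- Only finitely many a.e. conditions occur, so the equivalence may be proved for fixed u by
  -- linear algebra.
  rw [← ae_all_iff, ← Filter.eventually_and, ← Filter.eventually_and]
  refine Filter.eventually_congr ?_
  filter_upwards [hrj] with u hu
  simp only [hu]
  exact residual_orthogonal_iff hN (coeffMatrix F s) (fun k => kernelOp w (s k) u)
    (fun j => P j u) (μ u)

end Loss

end ContinuumNet

end

open ContinuumNet
theorem theorem3 {d l N : ℕ} (hN : 0 < N)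
    {Y : Set (Pt d)} (hY_open : IsOpen Y) (hY_bdd : Bornology.IsBounded Y)
    {U : Set (Pt l)} (hU_open : IsOpen U) (hU_bdd : Bornology.IsBounded U)
    {T : ℝ} (hT : 0 < T)
    {σ h : ℝ → ℝ} {L : ℝ≥0} (hσ_lip : LipschitzWith L σ)
    (hσ_diff : Differentiable ℝ σ) (hσ_pos : ∀ x, 0 < deriv σ x)
    (hh : ∀ ξ, h ξ = ξ)
    (fI : Fin N → L2 (leb Y)) (P : Fin N → L2 (leb U))
    (hfI : WeaklyLinearIndependent fI)
    (a : BiasSpace Y T) (b : WeightSpace Y T) (w : TerminalWeightSpace U Y) (μ : L2 (leb U))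
    {K : ℕ}
    (hK : K = finrank ℝ (Submodule.span ℝ (range (terminalState σ T fI a b))))
    (s : Fin K → L2 (leb Y)) (hs : Orthonormal ℝ s)
    (hs_mem : ∀ k, s k ∈ Submodule.span ℝ (range (terminalState σ T fI a b))) :
    IsCriticalPoint (loss σ h T fI P) ((a, b, w, μ) : ControlSpace Y U T) ↔
      (∀ j, IsLeastSquaresSolution (kernelOp w) (P j - μ) (terminalState σ T fI a b j)) ∧
      ∃ c : Fin K → L2 (leb U),
        (HasExpansion w s c ∧ SolvesNormalSystem (terminalState σ T fI a b) s P c) ∧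
        BiasFormula (terminalState σ T fI a b) s P c μ := by
  have : IsFiniteMeasure (leb Y) := ⟨by
    rw [Measure.restrict_apply_univ]
    exact hY_bdd.measure_lt_top⟩
  set F := terminalState σ T fI a b with hF
  have hFs : ∀ j, F j = ∑ k, coeffMatrix F s j k • s k := eq_sum_coeffMatrix F hs hK hs_mem
  rw [isCriticalPoint_loss_iff hN hσ_lip hσ_diff hσ_pos hT hh fI P hfI a b w μ hF rfl,
    sum_smul_inner_iff F hFs, residual_sums_eq_zero_iff hN F hFs P w μ rfl]
  refine and_congr (forall_congr' fun j => ?_) ?_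
  · unfold IsLeastSquaresSolution
    rw [← sub_eq_zero (b := ContinuousLinearMap.adjoint (kernelOp w) (P j - μ)), ← map_sub,
      sub_sub_eq_add_sub]
  · constructor
    · rintro ⟨h1, h2⟩
      exact ⟨_, ⟨(hasExpansion_iff hs w _).2 rfl, h1⟩, h2⟩
    · rintro ⟨c, ⟨h1, h2⟩, h3⟩
      rw [hasExpansion_iff hs] at h1
      subst h1
      exact ⟨h2, h3⟩
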